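/- Let $M$ be a smooth manifold of dimension $n\ge 3$ and let $F\colon TM\to\mathbb R$ be a Finsler metric: $F$ is continuous, positive off the zero section, satisfies $F(tv)=tF(v)$ for $t>0$, is of class $C^2$ on the complement of the zero section, and, with $E=\frac12F^2$, the matrix $g_{ij}=\partial^2E/\partial y^i\partial y^j$ is positive definite at all nonzero vectors, where $(x^i,y^i)$ are the coordinates on $TM$ induced by local coordinates $u^1,\dots,u^n$ of $M$. Let $F$ be smooth on the complement of the zero section and of a closed set $S\subset TM$ (the exceptional directions). Let $\alpha\colon M\to\mathbb R$ be smooth, let $p\in M$ with $d_p\alpha\neq0$, write $\alpha_l=\partial\alpha/\partial u^l$, and suppose that $S\cap T_pM$ is contained in a set $\mathbb R u$, $u\in T_pM$ (the case $S=\emptyset$ is that of Finsler metrics smooth on the whole complement of the zero section). Let $$G^l=\tfrac12g^{lm}\Big(y^k\frac{\partial^2E}{\partial y^m\partial x^k}-\frac{\partial E}{\partial x^m}\Big),\qquad P^l_{ijk}=-\frac{\partial^3G^l}{\partial y^i\partial y^j\partial y^k}$$ be the spray coefficients of $F$ and the mixed curvature of its Berwald connection, and let $\tilde P^l_{ijk}$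 be the mixed curvature for the conformally changed metric $\tilde F=e^{\alpha}F$. Assume that (i) the indicatrix $\{v\in T_pM: F(v)=1\}$, with the Riemannian metric induced by $g_{ij}$, has positive sectional curvature (at its points outside $S$); (ii) $\tilde P^l_{ijk}\alpha_l=P^l_{ijk}\alpha_l$ at all nonzero $v\in T_pM\setminus S$, for all $i,j,k$. Put $X^l=g^{lm}\alpha_m$ and $E_*=E\,X^l\alpha_l$ on $T_pM$. Then $E_*$ is a positive definite quadratic form on $T_pM$. Let $g^*_{ij}=\partial^2E_*/\partial y^i\partial y^j$ be the corresponding inner product on $T_pM$, $F_*=\sqrt{2E_*}$, and let $X_*(p)\in T_pM$ be the vector with components $X_*^l=g_*^{lk}\alpha_k(p)$, where $(g_*^{lk})=(g^*_{lk})^{-1}$. There is a real constant $K(p)$ such that for every nonzero $v\in T_pM$ with $v(\alpha)=0$ (that is, $v\in T_pN$, where $N$ is the level hypersurface of $\alpha$ through $p$), the function $y(t)=E(v+tX_*(p))$ is differentiable at $0$, $y(0)>0$, $F_*(v)>0$, and $$\frac{y'(0)}{y(0)}=\frac{K(p)}{F_*(v)} .$$ -/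

import Mathlib

open scoped Manifold ContDiff

noncomputable section

namespace ConformalFinsler

/-! ### Coordinate calculus -/

/-- The `i`-th partial derivative of a real function on `ℝ^m`. -/
def pd {m : ℕ} (i : Fin m) (f : EuclideanSpace ℝ (Fin m) → ℝ)
    (x : EuclideanSpace ℝ (Fin m)) : ℝ :=
  fderiv ℝ f x (EuclideanSpace.single i 1)

/-- The Hessian matrix `∂²f/∂y^i∂y^j`. -/
def hessian {m : ℕ} (f : EuclideanSpace ℝ (Fin m) → ℝ) (y : EuclideanSpace ℝ (Fin m)) :
    Matrix (Fin m) (Fin m) ℝ :=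
  Matrix.of fun i j => pd j (pd i f) y

/-! ### Sectional curvature of a Riemannian metric given in coordinates -/

/-- The Christoffel symbols `Γ^k_{ij}` of the metric `h`. -/
def christoffel {m : ℕ} (h : EuclideanSpace ℝ (Fin m) → Matrix (Fin m) (Fin m) ℝ)
    (k i j : Fin m) (x : EuclideanSpace ℝ (Fin m)) : ℝ :=
  (1 / 2) * ∑ l, (h x)⁻¹ k l *
    (pd i (fun z => h z j l) x + pd j (fun z => h z i l) x - pd l (fun z => h z i j) x)

/-- The components of the curvature tensor: `R(∂_i, ∂_j) ∂_k = ∑ l, riemann h l k i j • ∂_l`. -/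
def riemann {m : ℕ} (h : EuclideanSpace ℝ (Fin m) → Matrix (Fin m) (Fin m) ℝ)
    (l k i j : Fin m) (x : EuclideanSpace ℝ (Fin m)) : ℝ :=
  pd i (christoffel h l j k) x - pd j (christoffel h l i k) x
    + ∑ r, (christoffel h l i r x * christoffel h r j k x
          - christoffel h l j r x * christoffel h r i k x)

/-- The sectional curvature `h(R(a,b)b, a) / (h(a,a) h(b,b) - h(a,b)^2)`. -/
def sectionalCurvature {m : ℕ} (h : EuclideanSpace ℝ (Fin m) → Matrix (Fin m) (Fin m) ℝ)
    (x a b : EuclideanSpace ℝ (Fin m)) : ℝ :=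
  (∑ i, ∑ j, ∑ k, ∑ l, ∑ r, h x l r * riemann h l k i j x * a i * b j * b k * a r) /
    ((∑ i, ∑ j, h x i j * a i * a j) * (∑ i, ∑ j, h x i j * b i * b j)
      - (∑ i, ∑ j, h x i j * a i * b j) ^ 2)

/-- The pull-back of the symmetric tensor field `g` on `ℝ^n` along `φ : ℝ^m → ℝ^n`. -/
def pullbackMetric {m n : ℕ} (g : EuclideanSpace ℝ (Fin n) → Matrix (Fin n) (Fin n) ℝ)
    (φ : EuclideanSpace ℝ (Fin m) → EuclideanSpace ℝ (Fin n))
    (x : EuclideanSpace ℝ (Fin m)) : Matrix (Fin m) (Fin m) ℝ :=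
  Matrix.of fun i j => ∑ k, ∑ l, g (φ x) k l *
    pd i (fun z => φ z k) x * pd j (fun z => φ z l) x

/-! ### Finsler metrics -/

variable {n : ℕ} {M : Type*} [TopologicalSpace M] [ChartedSpace (EuclideanSpace ℝ (Fin n)) M]
  [IsManifold (𝓡 n) ∞ M]

/-- The Finslerian energy `E = F² / 2` on the tangent space `T_pM`. -/
def energy (F : TangentBundle (𝓡 n) M → ℝ) (p : M) (y : EuclideanSpace ℝ (Fin n)) : ℝ :=
  (1 / 2) * F ⟨p, y⟩ ^ 2

/-- The Riemann-Finsler metric `g_{ij} = ∂²E/∂y^i∂y^j` on `T_pM`. -/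
def metric (F : TangentBundle (𝓡 n) M → ℝ) (p : M) (y : EuclideanSpace ℝ (Fin n)) :
    Matrix (Fin n) (Fin n) ℝ :=
  hessian (energy F p) y

/-- `F` is a Finsler metric which is smooth away from the zero section and the closed set `S` of
exceptional directions, and of class `C²` on the whole complement of the zero section.
For `S = ∅` this is a Finsler metric in the usual sense. -/
structure IsFinslerMetric (F : TangentBundle (𝓡 n) M → ℝ) (S : Set (TangentBundle (𝓡 n) M)) :
    Prop where
  isClosed_exceptional : IsClosed S
  continuous : Continuous F
  pos : ∀ (p : M) (v : TangentSpace (𝓡 n) p), v ≠ 0 → 0 < F ⟨p, v⟩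
  homogeneous : ∀ (p : M) (v : TangentSpace (𝓡 n) p) (t : ℝ), 0 < t →
    F ⟨p, t • v⟩ = t * F ⟨p, v⟩
  contMDiffOn_two : ContMDiffOn (𝓡 n).tangent 𝓘(ℝ, ℝ) 2 F {w | w.2 ≠ 0}
  smooth : ContMDiffOn (𝓡 n).tangent 𝓘(ℝ, ℝ) ∞ F {w | w.2 ≠ 0 ∧ w ∉ S}
  posDef : ∀ (p : M) (v : TangentSpace (𝓡 n) p), v ≠ 0 → (metric F p v).PosDef

/-- The indicatrix `{v ∈ T_pM | F v = 1}`, with the Riemannian metric induced by `g_{ij}`, has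
positive sectional curvature (at the points outside `S`): in every local parametrization, all
sectional curvatures of the induced metric are positive. -/
def IndicatrixPositivelyCurved (F : TangentBundle (𝓡 n) M → ℝ)
    (S : Set (TangentBundle (𝓡 n) M)) (p : M) : Prop :=
  ∀ (U : Set (EuclideanSpace ℝ (Fin (n - 1))))
    (φ : EuclideanSpace ℝ (Fin (n - 1)) → EuclideanSpace ℝ (Fin n)),
    IsOpen U → ContDiffOn ℝ ∞ φ U →
    (∀ x ∈ U, Function.Injective (fderiv ℝ φ x)) →
    (∀ x ∈ U, F ⟨p, φ x⟩ = 1 ∧ (⟨p, φ x⟩ : TangentBundle (𝓡 n) M) ∉ S) →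
    ∀ x ∈ U, ∀ a b : EuclideanSpace ℝ (Fin (n - 1)), LinearIndependent ℝ ![a, b] →
      0 < sectionalCurvature (pullbackMetric (metric F p) φ) x a b

/-! ### The geodesic spray and the mixed curvature of the Berwald connection -/

/-- The energy `E(x, y)` in the coordinates `(x, y)` of the tangent bundle induced by the preferred
chart at `p`. -/
def localEnergy (F : TangentBundle (𝓡 n) M → ℝ) (p : M) (x y : EuclideanSpace ℝ (Fin n)) : ℝ :=
  (1 / 2) * F ((extChartAt (𝓡 n).tangent (⟨p, 0⟩ : TangentBundle (𝓡 n) M)).symm (x, y)) ^ 2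

/-- The geodesic spray coefficients
`G^l = (1/2) g^{lm} (y^k ∂²E/∂y^m∂x^k - ∂E/∂x^m)` in the preferred chart at `p`. -/
def spray (F : TangentBundle (𝓡 n) M → ℝ) (p : M) (l : Fin n)
    (x y : EuclideanSpace ℝ (Fin n)) : ℝ :=
  (1 / 2) * ∑ m, (hessian (localEnergy F p x) y)⁻¹ l m *
    ((∑ k, y k * pd m (fun y' => pd k (fun x' => localEnergy F p x' y') x) y)
      - pd m (fun x' => localEnergy F p x' y) x)

/-- The components `P^l_{ijk} = -∂³G^l/∂y^i∂y^j∂y^k` of the mixed curvature tensor of the Berwald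
connection at `y ∈ T_pM`, in the preferred chart at `p`. -/
def mixedCurvature (F : TangentBundle (𝓡 n) M → ℝ) (p : M) (l i j k : Fin n)
    (y : EuclideanSpace ℝ (Fin n)) : ℝ :=
  -pd k (pd j (pd i (spray F p l (extChartAt (𝓡 n) p p)))) y

/-! ### Conformal change and the associated Riemannian objects -/

/-- The conformal change `e^α F`. -/
def conformalChange (α : M → ℝ) (F : TangentBundle (𝓡 n) M → ℝ) :
    TangentBundle (𝓡 n) M → ℝ :=
  fun w => Real.exp (α w.1) * F w

/-- The partial derivatives `α_i = ∂α/∂u^i` at `p`, in the preferred chart at `p`. -/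
def dα (α : M → ℝ) (p : M) (i : Fin n) : ℝ :=
  mfderiv (𝓡 n) 𝓘(ℝ, ℝ) α p
    (show TangentSpace (𝓡 n) p from (EuclideanSpace.single i 1 : EuclideanSpace ℝ (Fin n)))

/-- The Riemann-Finsler gradient `X^l = g^{lm} α_m`. -/
def gradX (F : TangentBundle (𝓡 n) M → ℝ) (α : M → ℝ) (p : M) (l : Fin n)
    (y : EuclideanSpace ℝ (Fin n)) : ℝ :=
  ∑ m, (metric F p y)⁻¹ l m * dα α p m

/-- The associated energy `E_* = E X^l α_l` on `T_pM`. -/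
def energyStar (F : TangentBundle (𝓡 n) M → ℝ) (α : M → ℝ) (p : M)
    (y : EuclideanSpace ℝ (Fin n)) : ℝ :=
  energy F p y * ∑ l, gradX F α p l y * dα α p l

/-- The associated norm `F_* = √(2 E_*)` on `T_pM`. -/
def normStar (F : TangentBundle (𝓡 n) M → ℝ) (α : M → ℝ) (p : M)
    (y : EuclideanSpace ℝ (Fin n)) : ℝ :=
  Real.sqrt (2 * energyStar F α p y)

/-- The associated Riemannian metric `g*_{ij} = ∂²E_*/∂y^i∂y^j` at `p`. In the situation of the
theorem `E_*` is a quadratic form (this is part of its conclusion), so that the Hessian may be taken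
at any point of `T_pM`; the origin is used here. -/
def metricStar (F : TangentBundle (𝓡 n) M → ℝ) (α : M → ℝ) (p : M) :
    Matrix (Fin n) (Fin n) ℝ :=
  hessian (energyStar F α p) 0

/-- The Riemannian gradient `X_*^l = g_*^{lk} α_k` at `p`. -/
def gradStar (F : TangentBundle (𝓡 n) M → ℝ) (α : M → ℝ) (p : M) : EuclideanSpace ℝ (Fin n) :=
  WithLp.toLp 2 fun l => ∑ k, (metricStar F α p)⁻¹ l k * dα α p k

/-- The function `y(t) = E(v + t X_*(p))`. -/
def energyOnLine (F : TangentBundle (𝓡 n) M → ℝ) (α : M → ℝ) (p : M)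
    (v : EuclideanSpace ℝ (Fin n)) (t : ℝ) : ℝ :=
  energy F p (v + t • gradStar F α p)

end ConformalFinsler

end

noncomputable section

namespace ConformalFinsler

/-! ### Second derivatives along curves -/

/-! Write `α(y) = y^k α_k`. The conformal change turns the spray `G^l` into `G^l + α(y) y^l - E X^l`
(`spray_conformalChange`). Contraction with `α_l` adds `α(y)² - E_*`, so (ii) says that the third
derivatives of `E_*` vanish on `T_pM` off a line (`thirdPartial_energyStar`). For `n ≥ 3` the
complement of a line is connected, hence the Hessian of `E_*` is constant there; Euler's relation,
and continuity across the line, make `E_*` a quadratic form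
(`exists_quadratic_of_thirdPartial_eq_zero`). It is positive because the inverse of `g` is.

The rest concerns one vector space. Let `B` be the scalar product with energy `E_*`, let `l = dα`,
and let `x = X_*` represent `l` with respect to `B`. Then `E l(X) = B(y, y) / 2`, where `X` is the
gradient of `l` for the Hessian of `E`. The claim is that `E(a + t x)` is the same for all `B`-unit
vectors `a` of `ker l` (`energy_eq`): `E` is invariant under the `B`-rotations about `x`.

This is a maximum principle with doubled variables. If `log E(a + t x) - log E(a' + t x)` is
somewhere positive, then, since it tends to zero as `|t| → ∞`, adding a small barrier `e exp(L t)`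
still leaves an interior maximum on a compact set. There the second variation is taken along a
simultaneous rotation of `a` and `a'` and a shift along `x`, with speeds read off from the gradient
`X` at `a' + t x`. Cauchy-Schwarz compares the two Hessians, because `E l(X)` has the same value at
both points. All surviving terms are multiples of `e L exp(L t)`, and dividing by it bounds `L`
independently of `e` (`inequality_of_max`, `exponent_bound`); a large `L` gives a contradiction
(`log_le_log`).

By this invariance and homogeneity, the logarithmic derivative of `E` along `x` at `v ∈ ker l`
depends only on the `B`-norm of `v` and is homogeneous of degree `-1`, which gives `K`
(`exists_const_deriv_div`). -/

theorem second_derivative_nonpos_of_isLocalMax {f f₁ : ℝ → ℝ} {a d : ℝ} (hmax : IsLocalMax f a)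
    (hf : ∀ᶠ s in nhds a, HasDerivAt f (f₁ s) s) (hf₁ : HasDerivAt f₁ d a) :
    f₁ a = 0 ∧ d ≤ 0 := by
  have h0 : f₁ a = 0 := by
    have := hmax.deriv_eq_zero
    rwa [hf.self_of_nhds.deriv] at this
  refine ⟨h0, ?_⟩
  by_contra! hd
  have hev : deriv f =ᶠ[nhds a] f₁ := hf.mono fun s hs => hs.deriv
  have h2 : deriv (deriv f) a = d := by rw [hev.deriv_eq, hf₁.deriv]
  -- With `d > 0` the second derivative test makes the maximum a minimum as well, so `f` is locally
  -- constant and `d = 0`.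
  have hmin : IsLocalMin f a := by
    apply isLocalMin_of_deriv_deriv_pos
    · rwa [h2]
    · rw [hev.self_of_nhds, h0]
    · exact hf.self_of_nhds.continuousAt
  have hc : f =ᶠ[nhds a] fun _ => f a := by
    filter_upwards [hmax, hmin] with s h1 h2 using le_antisymm h1 h2
  have hc' : deriv f =ᶠ[nhds a] fun _ => 0 := by
    have := hc.deriv
    simpa using this
  have : deriv (deriv f) a = 0 := by rw [hc'.deriv_eq]; simp
  linarith

section Analysis

variable {V : Type*} [NormedAddCommGroup V] [NormedSpace ℝ V]

theorem hasDerivAt_fderiv_comp {E : V → ℝ} {c c₁ : ℝ → V} {c₂ : V} {a : ℝ}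
    (hE : ContDiffAt ℝ 2 E (c a)) (hc : ∀ s, HasDerivAt c (c₁ s) s)
    (hc₁ : HasDerivAt c₁ c₂ a) :
    (∀ᶠ s in nhds a, HasDerivAt (fun s => E (c s)) (fderiv ℝ E (c s) (c₁ s)) s) ∧
    HasDerivAt (fun s => fderiv ℝ E (c s) (c₁ s))
      (fderiv ℝ (fderiv ℝ E) (c a) (c₁ a) (c₁ a) + fderiv ℝ E (c a) c₂) a := by
  have hcont : Filter.Tendsto c (nhds a) (nhds (c a)) := (hc a).continuousAt
  constructor
  · have h1 : ∀ᶠ y in nhds (c a), ContDiffAt ℝ 2 E y := hE.eventually (by simp)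
    filter_upwards [hcont.eventually h1] with s hs
    exact (hs.differentiableAt (by norm_num)).hasFDerivAt.comp_hasDerivAt s (hc s)
  · have h2 : DifferentiableAt ℝ (fderiv ℝ E) (c a) :=
      (hE.fderiv_right (m := 1) (by norm_num)).differentiableAt (by norm_num)
    have h3 := h2.hasFDerivAt.comp_hasDerivAt a (hc a)
    exact h3.clm_apply hc₁

theorem hasDerivAt_log_comp {E : V → ℝ} {c c₁ : ℝ → V} {c₂ : V} {a : ℝ}
    (hE : ContDiffAt ℝ 2 E (c a)) (hpos : E (c a) ≠ 0) (hc : ∀ s, HasDerivAt c (c₁ s) s)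
    (hc₁ : HasDerivAt c₁ c₂ a) :
    (∀ᶠ s in nhds a,
      HasDerivAt (fun s => Real.log (E (c s))) (fderiv ℝ E (c s) (c₁ s) / E (c s)) s) ∧
    HasDerivAt (fun s => fderiv ℝ E (c s) (c₁ s) / E (c s))
      ((fderiv ℝ (fderiv ℝ E) (c a) (c₁ a) (c₁ a) + fderiv ℝ E (c a) c₂) / E (c a)
        - (fderiv ℝ E (c a) (c₁ a) / E (c a)) ^ 2) a := by
  obtain ⟨h1, h2⟩ := hasDerivAt_fderiv_comp hE hc hc₁
  have hne : ∀ᶠ s in nhds a, E (c s) ≠ 0 :=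
    h1.self_of_nhds.continuousAt.eventually_ne hpos
  refine ⟨?_, ?_⟩
  · filter_upwards [h1, hne] with s hs hs' using hs.log hs'
  · have := h2.div h1.self_of_nhds hpos
    convert! this using 1
    field_simp

/-! ### Homogeneous functions -/

/-- Differentials of `2`-homogeneous functions are `1`-homogeneous. -/
theorem fderiv_smul_of_homogeneous {E : V → ℝ} (hom : ∀ t : ℝ, 0 < t → ∀ y, E (t • y) = t ^ 2 * E y)
    {y : V} {t : ℝ} (ht : 0 < t) :
    fderiv ℝ E (t • y) = t • fderiv ℝ E y := by
  have h1 : (fun z => E (t • z)) = fun z => t ^ 2 * E z := funext fun z => hom t ht z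
  have h2 : fderiv ℝ (fun z => E (t • z)) y = t • fderiv ℝ E (t • y) := by
    exact fderiv_comp_smul (f := E) (x := y) t
  have h3 : fderiv ℝ (fun z => t ^ 2 * E z) y = t ^ 2 • fderiv ℝ E y := by
    exact congrFun (fderiv_const_smul_field (R := ℝ) (f := E) (t ^ 2)) y
  rw [h1, h3] at h2
  have h4 : t • (fderiv ℝ E (t • y)) = t • (t • fderiv ℝ E y) := by
    rw [← h2, smul_smul, sq]
  exact smul_right_injective _ ht.ne' h4

theorem fderiv_apply_self_of_homogeneous {E : V → ℝ}
    (hom : ∀ t : ℝ, 0 < t → ∀ y, E (t • y) = t ^ 2 * E y)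
    {y : V} (hE : DifferentiableAt ℝ E y) : fderiv ℝ E y y = 2 * E y := by
  have hc : HasDerivAt (fun t : ℝ => t • y) y 1 := by
    simpa using (hasDerivAt_id (1 : ℝ)).smul_const y
  have h1 : HasDerivAt (fun t : ℝ => E (t • y)) (fderiv ℝ E y y) 1 := by
    have : HasFDerivAt E (fderiv ℝ E y) ((fun t : ℝ => t • y) 1) := by
      simpa using hE.hasFDerivAt
    exact this.comp_hasDerivAt 1 hc
  have h2 : HasDerivAt (fun t : ℝ => E (t • y)) (2 * E y) 1 := by
    have h3 : HasDerivAt (fun t : ℝ => t ^ 2 * E y) (2 * E y) 1 := by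
      simpa using (hasDerivAt_pow 2 (1 : ℝ)).mul_const (E y)
    refine h3.congr_of_eventuallyEq ?_
    filter_upwards [lt_mem_nhds (show (0 : ℝ) < 1 by norm_num)] with t ht using hom t ht y
  exact h1.unique h2

theorem fderiv_fderiv_apply_self_of_homogeneous {E : V → ℝ}
    (hom : ∀ t : ℝ, 0 < t → ∀ y, E (t • y) = t ^ 2 * E y)
    {y : V} (hE : ContDiffAt ℝ 2 E y) : fderiv ℝ (fderiv ℝ E) y y = fderiv ℝ E y := by
  have hc : HasDerivAt (fun t : ℝ => t • y) y 1 := by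
    simpa using (hasDerivAt_id (1 : ℝ)).smul_const y
  have hd : DifferentiableAt ℝ (fderiv ℝ E) y :=
    (hE.fderiv_right (m := 1) (by norm_num)).differentiableAt (by norm_num)
  have h1 : HasDerivAt (fun t : ℝ => fderiv ℝ E (t • y)) (fderiv ℝ (fderiv ℝ E) y y) 1 := by
    have : HasFDerivAt (fderiv ℝ E) (fderiv ℝ (fderiv ℝ E) y) ((fun t : ℝ => t • y) 1) := by
      simpa using hd.hasFDerivAt
    exact this.comp_hasDerivAt 1 hc
  have h2 : HasDerivAt (fun t : ℝ => fderiv ℝ E (t • y)) (fderiv ℝ E y) 1 := by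
    have h3 : HasDerivAt (fun t : ℝ => t • fderiv ℝ E y) (fderiv ℝ E y) 1 := by
      simpa using (hasDerivAt_id (1 : ℝ)).smul_const (fderiv ℝ E y)
    refine h3.congr_of_eventuallyEq ?_
    filter_upwards [lt_mem_nhds (show (0 : ℝ) < 1 by norm_num)] with t ht
      using fderiv_smul_of_homogeneous hom ht
  exact h1.unique h2

end Analysis

/-! ### Rotational symmetry of energies with a quadratic `E l(X)`. -/

section Rigidity

variable {V : Type*} [NormedAddCommGroup V] [NormedSpace ℝ V]

/-- Energies `E` of Minkowski norms (of class `C²`) such that, `X` denoting the gradient of the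
linear form `l` with respect to the Hessian metric, `E l(X)` is the energy of the scalar product
`B`. The vector `x` represents `l` with respect to `B`. -/
structure IsQuadraticGradientEnergy (B : V →L[ℝ] V →L[ℝ] ℝ) (l : V →L[ℝ] ℝ) (x : V) (E : V → ℝ) :
    Prop where
  symm : ∀ v w, B v w = B w v
  bilin_pos : ∀ v, v ≠ 0 → 0 < B v v
  repr : ∀ v, B x v = l v
  vec_ne : x ≠ 0
  pos : ∀ y, y ≠ 0 → 0 < E y
  hom : ∀ t : ℝ, 0 < t → ∀ y, E (t • y) = t ^ 2 * E y
  smooth : ∀ y, y ≠ 0 → ContDiffAt ℝ 2 E y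
  hess_pos : ∀ y, y ≠ 0 → ∀ z, z ≠ 0 → 0 < fderiv ℝ (fderiv ℝ E) y z z
  grad : ∀ y, y ≠ 0 → ∃ X, (∀ z, fderiv ℝ (fderiv ℝ E) y X z = l z) ∧ E y * l X = B y y / 2

namespace IsQuadraticGradientEnergy

variable {B : V →L[ℝ] V →L[ℝ] ℝ} {l : V →L[ℝ] ℝ} {x : V} {E : V → ℝ}

theorem hess_symm (h : IsQuadraticGradientEnergy B l x E) {y : V} (hy : y ≠ 0) (z w : V) :
    fderiv ℝ (fderiv ℝ E) y z w = fderiv ℝ (fderiv ℝ E) y w z :=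
  (h.smooth y hy).isSymmSndFDerivAt (by simp) z w

theorem cauchy_schwarz (h : IsQuadraticGradientEnergy B l x E) {y : V} (hy : y ≠ 0) (z w : V) :
    fderiv ℝ (fderiv ℝ E) y z w ^ 2 ≤
      fderiv ℝ (fderiv ℝ E) y z z * fderiv ℝ (fderiv ℝ E) y w w := by
  set g := fderiv ℝ (fderiv ℝ E) y with hg
  by_cases hz : z = 0
  · simp [hz]
  have hp := h.hess_pos y hy z hz
  rw [← hg] at hp
  have hnn : 0 ≤ g (g z z • w - g z w • z) (g z z • w - g z w • z) := by
    by_cases h0 : g z z • w - g z w • z = 0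
    · simp [h0]
    · exact (h.hess_pos y hy _ h0).le
  have hs : g w z = g z w := h.hess_symm hy w z
  simp only [map_sub, map_smul, _root_.sub_apply, _root_.smul_apply,
    smul_eq_mul, hs] at hnn
  have : 0 ≤ g z z * (g z z * g w w - g z w ^ 2) := by nlinarith
  have := nonneg_of_mul_nonneg_right this hp
  linarith

/-- Cauchy-Schwarz against the gradient `X`, whose square length is `l X`. Equality holds at `z =
X`, and the factor `B y y / 2` is the same at `a + t x` and `a' + t x`; this is what makes Hessians
at the two points comparable. -/
theorem sq_le (h : IsQuadraticGradientEnergy B l x E) {y : V} (hy : y ≠ 0) (z : V) :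
    l z ^ 2 * E y ≤ B y y / 2 * fderiv ℝ (fderiv ℝ E) y z z := by
  obtain ⟨X, hX, hq⟩ := h.grad y hy
  have := h.cauchy_schwarz hy X z
  rw [hX, hX] at this
  have hE := h.pos y hy
  calc l z ^ 2 * E y ≤ l X * fderiv ℝ (fderiv ℝ E) y z z * E y := by gcongr
    _ = _ := by rw [← hq]; ring

theorem apply_vec_pos (h : IsQuadraticGradientEnergy B l x E) : 0 < l x := by
  rw [← h.repr]; exact h.bilin_pos x h.vec_ne

theorem fderiv_self (h : IsQuadraticGradientEnergy B l x E) {y : V} (hy : y ≠ 0) :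
    fderiv ℝ E y y = 2 * E y :=
  fderiv_apply_self_of_homogeneous h.hom ((h.smooth y hy).differentiableAt (by norm_num))

theorem hess_self (h : IsQuadraticGradientEnergy B l x E) {y : V} (hy : y ≠ 0) (z : V) :
    fderiv ℝ (fderiv ℝ E) y y z = fderiv ℝ E y z := by
  rw [fderiv_fderiv_apply_self_of_homogeneous h.hom (h.smooth y hy)]

/-- Take `y = z = x` in `sq_le`: by Euler's relation the Hessian term is `2 E x`, and `B x x = l x`.
-/
theorem apply_vec_le_one (h : IsQuadraticGradientEnergy B l x E) : l x ≤ 1 := by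
  have h1 := h.sq_le h.vec_ne x
  rw [h.hess_self h.vec_ne, h.fderiv_self h.vec_ne, h.repr] at h1
  have hE := h.pos x h.vec_ne
  have hl := h.apply_vec_pos
  have : l x * (l x * E x) ≤ 1 * (l x * E x) := by nlinarith
  exact le_of_mul_le_mul_right this (by positivity)

/-- The curve `cos (w s) a + sin (w s) k + (t + b s) x`. -/
def curve (a k x : V) (w b t s : ℝ) : V :=
  Real.cos (w * s) • a + Real.sin (w * s) • k + (t + b * s) • x

def curveDeriv (a k x : V) (w b s : ℝ) : V :=
  (-(w * Real.sin (w * s))) • a + (w * Real.cos (w * s)) • k + b • x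

theorem hasDerivAt_curve (a k x : V) (w b t s : ℝ) :
    HasDerivAt (curve a k x w b t) (curveDeriv a k x w b s) s := by
  have h0 : HasDerivAt (fun s : ℝ => w * s) w s := by simpa using (hasDerivAt_id s).const_mul w
  have h1 := h0.cos.smul_const a
  have h2 := h0.sin.smul_const k
  have h3 : HasDerivAt (fun s : ℝ => t + b * s) b s := by
    simpa using ((hasDerivAt_id s).const_mul b).const_add t
  have := (h1.add h2).add (h3.smul_const x)
  convert! this using 1
  simp only [curveDeriv]
  congr 3 <;> ring

theorem hasDerivAt_curveDeriv (a k x : V) (w b : ℝ) :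
    HasDerivAt (curveDeriv a k x w b) (-(w ^ 2) • a) 0 := by
  have h0 : HasDerivAt (fun s : ℝ => w * s) w 0 := by
    simpa using (hasDerivAt_id (0 : ℝ)).const_mul w
  have h1 := ((h0.sin.const_mul w).neg).smul_const a
  have h2 := (h0.cos.const_mul w).smul_const k
  have := (h1.add h2).add_const (b • x)
  convert! this using 1
  simp [sq]

@[simp] theorem curve_zero (a k x : V) (w b t : ℝ) : curve a k x w b t 0 = a + t • x := by
  simp [curve]

@[simp] theorem curveDeriv_zero (a k x : V) (w b : ℝ) :
    curveDeriv a k x w b 0 = w • k + b • x := by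
  simp [curveDeriv]

/-- The unit sphere of the kernel of `l`. -/
def kerSphere (B : V →L[ℝ] V →L[ℝ] ℝ) (l : V →L[ℝ] ℝ) : Set V := {a | l a = 0 ∧ B a a = 1}

theorem bilin_vec (h : IsQuadraticGradientEnergy B l x E) {a : V} (ha : l a = 0) : B x a = 0 := by
  rw [h.repr, ha]

theorem bilin_vec' (h : IsQuadraticGradientEnergy B l x E) {a : V} (ha : l a = 0) : B a x = 0 := by
  rw [h.symm, h.repr, ha]

theorem bilin_add_smul_vec (h : IsQuadraticGradientEnergy B l x E) {a : V}
    (ha : a ∈ kerSphere B l) (t : ℝ) : B (a + t • x) (a + t • x) = 1 + t ^ 2 * l x := by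
  simp only [map_add, map_smul, _root_.add_apply, _root_.smul_apply,
    smul_eq_mul, h.bilin_vec ha.1, h.bilin_vec' ha.1, ha.2, h.repr]
  ring

theorem add_smul_vec_ne (h : IsQuadraticGradientEnergy B l x E) {a : V}
    (ha : a ∈ kerSphere B l) (t : ℝ) : a + t • x ≠ 0 := by
  intro h0
  have := h.bilin_add_smul_vec ha t
  rw [h0] at this
  have hl := h.apply_vec_pos
  simp only [map_zero] at this
  nlinarith [sq_nonneg t]

theorem curve_mem (h : IsQuadraticGradientEnergy B l x E) {a k : V}
    (ha : a ∈ kerSphere B l) (hk : k ∈ kerSphere B l) (hak : B a k = 0) (c : ℝ) :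
    Real.cos c • a + Real.sin c • k ∈ kerSphere B l := by
  have hka : B k a = 0 := by rw [h.symm, hak]
  refine ⟨by simp [ha.1, hk.1], ?_⟩
  simp only [map_add, map_smul, _root_.add_apply, _root_.smul_apply,
    smul_eq_mul, ha.2, hk.2, hak, hka]
  nlinarith [Real.sin_sq_add_cos_sq c]

/-- The logarithmic derivative of `E` in the direction of `x`. -/
def logDeriv (E : V → ℝ) (x y : V) : ℝ := fderiv ℝ E y x / E y

/-- First and second order conditions at an interior maximum point of
`log E(a + t x) - log E(a' + t x) + e exp(L t)`. -/
theorem conditions_of_max (h : IsQuadraticGradientEnergy B l x E) {a a' : V} {t e L Z : ℝ}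
    (ha : a ∈ kerSphere B l) (ha' : a' ∈ kerSphere B l) (htZ : |t| < Z)
    (hmax : ∀ c ∈ kerSphere B l, ∀ c' ∈ kerSphere B l, ∀ s, |s| ≤ Z →
      Real.log (E (c + s • x)) - Real.log (E (c' + s • x)) + e * Real.exp (L * s) ≤
      Real.log (E (a + t • x)) - Real.log (E (a' + t • x)) + e * Real.exp (L * t))
    {k k' : V} (hk : k ∈ kerSphere B l) (hk' : k' ∈ kerSphere B l)
    (hak : B a k = 0) (hak' : B a' k' = 0) (w b : ℝ) :
    fderiv ℝ E (a + t • x) (w • k + b • x) / E (a + t • x)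
      - fderiv ℝ E (a' + t • x) (w • k' + b • x) / E (a' + t • x)
      + e * L * b * Real.exp (L * t) = 0 ∧
    ((fderiv ℝ (fderiv ℝ E) (a + t • x) (w • k + b • x) (w • k + b • x)
        - w ^ 2 * fderiv ℝ E (a + t • x) a) / E (a + t • x)
        - (fderiv ℝ E (a + t • x) (w • k + b • x) / E (a + t • x)) ^ 2)
      - ((fderiv ℝ (fderiv ℝ E) (a' + t • x) (w • k' + b • x) (w • k' + b • x)
        - w ^ 2 * fderiv ℝ E (a' + t • x) a') / E (a' + t • x)
        - (fderiv ℝ E (a' + t • x) (w • k' + b • x) / E (a' + t • x)) ^ 2)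
      + e * L ^ 2 * b ^ 2 * Real.exp (L * t) ≤ 0 := by
  have hy := h.add_smul_vec_ne ha t
  have hy' := h.add_smul_vec_ne ha' t
  have A := hasDerivAt_log_comp (E := E) (c := curve a k x w b t) (a := 0)
    (by simpa using h.smooth _ hy) (by simpa using (h.pos _ hy).ne')
    (fun s => hasDerivAt_curve a k x w b t s) (hasDerivAt_curveDeriv a k x w b)
  have A' := hasDerivAt_log_comp (E := E) (c := curve a' k' x w b t) (a := 0)
    (by simpa using h.smooth _ hy') (by simpa using (h.pos _ hy').ne')
    (fun s => hasDerivAt_curve a' k' x w b t s) (hasDerivAt_curveDeriv a' k' x w b)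
  have G : ∀ s, HasDerivAt (fun s : ℝ => e * Real.exp (L * (t + b * s)))
      (e * L * b * Real.exp (L * (t + b * s))) s := by
    intro s
    have h3 : HasDerivAt (fun s : ℝ => L * (t + b * s)) (L * b) s := by
      simpa using (((hasDerivAt_id s).const_mul b).const_add t).const_mul L
    convert! h3.exp.const_mul e using 1
    ring
  have G' : HasDerivAt (fun s : ℝ => e * L * b * Real.exp (L * (t + b * s)))
      (e * L ^ 2 * b ^ 2 * Real.exp (L * t)) 0 := by
    have h3 : HasDerivAt (fun s : ℝ => L * (t + b * s)) (L * b) 0 := by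
      simpa using (((hasDerivAt_id (0 : ℝ)).const_mul b).const_add t).const_mul L
    convert! h3.exp.const_mul (e * L * b) using 1
    simp
    ring
  have hlm : IsLocalMax (fun s => Real.log (E (curve a k x w b t s))
      - Real.log (E (curve a' k' x w b t s)) + e * Real.exp (L * (t + b * s))) 0 := by
    -- For small `s` the height `t + b s` stays in the range where the maximum is known; this is
    -- where interiority is used.
    have hc : ContinuousAt (fun s : ℝ => |t + b * s|) 0 := by fun_prop
    have : ∀ᶠ s in nhds (0 : ℝ), |t + b * s| < Z :=
      hc.eventually (gt_mem_nhds (by simpa using htZ))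
    filter_upwards [this] with s hs
    simpa [curve] using hmax _ (h.curve_mem ha hk hak (w * s)) _ (h.curve_mem ha' hk' hak' (w * s))
      (t + b * s) hs.le
  have := second_derivative_nonpos_of_isLocalMax hlm
    (f₁ := fun s => fderiv ℝ E (curve a k x w b t s) (curveDeriv a k x w b s)
        / E (curve a k x w b t s)
      - fderiv ℝ E (curve a' k' x w b t s) (curveDeriv a' k' x w b s) / E (curve a' k' x w b t s)
      + e * L * b * Real.exp (L * (t + b * s)))
    (by
      filter_upwards [A.1, A'.1] with s hs hs'
      exact (hs.sub hs').add (G s))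
    ((A.2.sub A'.2).add G')
  simp only [curve_zero, curveDeriv_zero, mul_zero, add_zero, map_smul (fderiv ℝ E _) (-(w ^ 2)),
    smul_eq_mul] at this
  refine ⟨this.1, ?_⟩
  convert this.2 using 5 <;> ring

theorem normalize_mem (h : IsQuadraticGradientEnergy B l x E) {v : V} (hv : v ≠ 0) (hl : l v = 0) :
    (Real.sqrt (B v v))⁻¹ • v ∈ kerSphere B l := by
  have hp := h.bilin_pos v hv
  refine ⟨by simp [hl], ?_⟩
  simp only [map_smul, _root_.smul_apply, smul_eq_mul]
  have := Real.mul_self_sqrt hp.le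
  have h0 : Real.sqrt (B v v) ≠ 0 := (Real.sqrt_pos.2 hp).ne'
  field_simp
  nlinarith

theorem exists_orthogonal [FiniteDimensional ℝ V] (h : IsQuadraticGradientEnergy B l x E)
    (hdim : 3 ≤ Module.finrank ℝ V) (a : V) : ∃ k ∈ kerSphere B l, B a k = 0 := by
  let f : V →ₗ[ℝ] ℝ × ℝ := (l : V →ₗ[ℝ] ℝ).prod (B a : V →ₗ[ℝ] ℝ)
  have hf : LinearMap.ker f ≠ ⊥ := LinearMap.ker_ne_bot_of_finrank_lt (by simp; omega)
  obtain ⟨v, hv, hv0⟩ := (Submodule.ne_bot_iff _).1 hf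
  have hv' : l v = 0 ∧ B a v = 0 := by simpa [f] using hv
  exact ⟨_, h.normalize_mem hv0 hv'.1, by simp [hv'.2]⟩

/-- The orthogonal decomposition of a vector with respect to `a` and `x`. -/
theorem exists_decomposition [FiniteDimensional ℝ V] (h : IsQuadraticGradientEnergy B l x E)
    (hdim : 3 ≤ Module.finrank ℝ V) {a : V} (ha : a ∈ kerSphere B l) (X : V) (t : ℝ) :
    ∃ k ∈ kerSphere B l, B a k = 0 ∧ ∃ m w b : ℝ, X = m • (a + t • x) + (w • k + b • x) ∧
      m ^ 2 + w ^ 2 ≤ B X X ∧ l X = (m * t + b) * l x := by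
  have hx := h.apply_vec_pos
  set b₀ := l X / l x with hb₀
  set r := X - b₀ • x with hr
  have hlr : l r = 0 := by simp [hr, hb₀, hx.ne']
  set m := B a r with hm
  set τ := r - m • a with hτ
  have hlτ : l τ = 0 := by simp [hτ, hlr, ha.1]
  have haτ : B a τ = 0 := by simp [hτ, ha.2, hm]
  obtain ⟨k, hk, hak, w, hw⟩ : ∃ k ∈ kerSphere B l, B a k = 0 ∧ ∃ w : ℝ, τ = w • k := by
    by_cases h0 : τ = 0
    · obtain ⟨k, hk, hak⟩ := h.exists_orthogonal hdim a
      exact ⟨k, hk, hak, 0, by simp [h0]⟩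
    · refine ⟨_, h.normalize_mem h0 hlτ, by simp [haτ], Real.sqrt (B τ τ), ?_⟩
      rw [smul_smul, mul_inv_cancel₀ (Real.sqrt_pos.2 (h.bilin_pos τ h0)).ne', one_smul]
  have hX : X = m • a + w • k + b₀ • x := by
    rw [← hw, hτ, hr]; abel
  refine ⟨k, hk, hak, m, w, b₀ - m * t, ?_, ?_, ?_⟩
  · rw [hX]; module
  · have hka : B k a = 0 := by rw [h.symm, hak]
    have : B X X = m ^ 2 + w ^ 2 + b₀ ^ 2 * l x := by
      rw [hX]
      simp only [map_add, map_smul, _root_.add_apply, _root_.smul_apply, smul_eq_mul,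
        h.bilin_vec ha.1, h.bilin_vec' ha.1, h.bilin_vec hk.1, h.bilin_vec' hk.1, ha.2, hk.2,
        h.repr, hak, hka]
      ring
    rw [this]
    nlinarith [mul_nonneg (sq_nonneg b₀) hx.le]
  · rw [hb₀]; field_simp; ring

/-- Here `m`, `b` are coefficients of `X`, `c = l x`, `e` is the energy and `p` the logarithmic
derivative along `x`. The hypotheses are `E l(X) = B(y, y) / 2` and the pairing of `X` with `y`;
eliminating `m` keeps `b` away from zero. -/
theorem slope_bound {m t b c e p : ℝ} (hc : 0 < c) (hc1 : c ≤ 1)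
    (hq : e * ((m * t + b) * c) = (1 + t ^ 2 * c) / 2)
    (h1 : m * (2 * e) + b * p * e = t * c) : 1 ≤ b * (e * (2 - t * p)) := by
  have hkey : b * (e * (2 - t * p)) * c = 1 + t ^ 2 * c - t ^ 2 * c * c := by
    linear_combination 2 * hq - c * t * h1
  have : 1 * c ≤ b * (e * (2 - t * p)) * c := by
    rw [hkey]
    nlinarith [mul_nonneg (mul_nonneg (sq_nonneg t) hc.le) (sub_nonneg.2 hc1)]
  exact le_of_mul_le_mul_right this hc

/-- Here `N / e` and `N' / e'` are the normalized Hessian terms at the two points and `g` is the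
slope of the barrier. The first order condition `p - p' = -g` turns every difference between the
points into a multiple of `g`, which is then divided out. -/
theorem barrier_bound {N N' e e' m b w t p p' L g : ℝ} (he : 0 < e) (he' : 0 < e') (hg : 0 < g)
    (hpp : p - p' = -g)
    (hN : 2 * m ^ 2 + 2 * m * b * p' + N' / e' ≤ 2 * m ^ 2 + 2 * m * b * p + N / e)
    (h : (N - w ^ 2 * ((2 - t * p) * e)) / e - (b * p * e / e) ^ 2 -
      ((N' - w ^ 2 * ((2 - t * p') * e')) / e' - (b * p' * e' / e') ^ 2)
      + g * (b ^ 2 * L) ≤ 0) :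
    b ^ 2 * L ≤ -2 * m * b + t * w ^ 2 - b ^ 2 * (p + p') := by
  have e1 : (N - w ^ 2 * ((2 - t * p) * e)) / e = N / e - w ^ 2 * (2 - t * p) := by field_simp
  have e2 : (N' - w ^ 2 * ((2 - t * p') * e')) / e' = N' / e' - w ^ 2 * (2 - t * p') := by
    field_simp
  have e3 : b * p * e / e = b * p := by field_simp
  have e4 : b * p' * e' / e' = b * p' := by field_simp
  rw [e1, e2, e3, e4] at h
  obtain rfl : p = p' - g := by linarith
  have : b ^ 2 * L * g ≤ (-2 * m * b + t * w ^ 2 - b ^ 2 * (p' - g + p')) * g := by linarith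
  exact le_of_mul_le_mul_right this hg

/-- Decompose `X`, the gradient at `y' = a' + t x`, as `m y' + (w k' + b x)`, and use these `w`, `b`
as speeds of the variation. The transplanted vector `m y + (w k + b x)` at `y = a + t x` has the
same value under `l`, so `sq_le` bounds its Hessian length from below by that of `X`, after division
by the energies. -/
theorem inequality_of_max [FiniteDimensional ℝ V] (h : IsQuadraticGradientEnergy B l x E)
    (hdim : 3 ≤ Module.finrank ℝ V) {a a' : V} {t e L Z : ℝ}
    (ha : a ∈ kerSphere B l) (ha' : a' ∈ kerSphere B l) (htZ : |t| < Z) (he : 0 < e) (hL : 0 < L)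
    (hmax : ∀ c ∈ kerSphere B l, ∀ c' ∈ kerSphere B l, ∀ s, |s| ≤ Z →
      Real.log (E (c + s • x)) - Real.log (E (c' + s • x)) + e * Real.exp (L * s) ≤
      Real.log (E (a + t • x)) - Real.log (E (a' + t • x)) + e * Real.exp (L * t)) :
    ∃ X, (∀ z, fderiv ℝ (fderiv ℝ E) (a' + t • x) X z = l z) ∧
      E (a' + t • x) * l X = B (a' + t • x) (a' + t • x) / 2 ∧ ∃ m w b : ℝ,
      m ^ 2 + w ^ 2 ≤ B X X ∧
      1 ≤ b * (E (a' + t • x) * (2 - t * logDeriv E x (a' + t • x))) ∧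
      b ^ 2 * L ≤ -2 * m * b + t * w ^ 2
        - b ^ 2 * (logDeriv E x (a + t • x) + logDeriv E x (a' + t • x)) := by
  have hy := h.add_smul_vec_ne ha t
  have hy' := h.add_smul_vec_ne ha' t
  obtain ⟨X, hX, hq⟩ := h.grad _ hy'
  obtain ⟨k', hk', hak', m, w, b, hXe, hmw, hlX⟩ := h.exists_decomposition hdim ha' X t
  obtain ⟨k, hk, hak⟩ := h.exists_orthogonal hdim a
  -- The variations along `(k, k')` and `(-k, k')` together show that both tangential derivatives
  -- vanish separately.
  have hnk : -k ∈ kerSphere B l := ⟨by simp [hk.1], by simp [hk.2]⟩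
  have C := fun w b => h.conditions_of_max ha ha' htZ hmax hk hk' hak hak' w b
  have C1 := (C 1 0).1
  have C2 := (h.conditions_of_max ha ha' htZ hmax hnk hk' (by simp [hak]) hak' 1 0).1
  have C3 := (C 0 1).1
  have C4 := (C w b).2
  simp only [logDeriv]
  set y := a + t • x with hydef
  set y' := a' + t • x with hydef'
  have hEy := h.pos y hy
  have hEy' := h.pos y' hy'
  have hxpos := h.apply_vec_pos
  have hxle := h.apply_vec_le_one
  simp only [map_neg, one_smul, zero_smul, add_zero, mul_zero,
    zero_mul, zero_add, mul_one] at C1 C2 C3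
  have hdk : fderiv ℝ E y k = 0 := by
    have : fderiv ℝ E y k / E y = 0 := by rw [neg_div] at C2; linarith
    rcases div_eq_zero_iff.1 this with h0 | h0
    · exact h0
    · exact absurd h0 hEy.ne'
  have hdk' : fderiv ℝ E y' k' = 0 := by
    have : fderiv ℝ E y' k' / E y' = 0 := by rw [neg_div] at C2; linarith
    rcases div_eq_zero_iff.1 this with h0 | h0
    · exact h0
    · exact absurd h0 hEy'.ne'
  set p := fderiv ℝ E y x / E y with hp
  set p' := fderiv ℝ E y' x / E y' with hp'
  have hdx : fderiv ℝ E y x = p * E y := by rw [hp]; field_simp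
  have hdx' : fderiv ℝ E y' x = p' * E y' := by rw [hp']; field_simp
  have hda : fderiv ℝ E y a = (2 - t * p) * E y := by
    have : fderiv ℝ E y (a + t • x) = 2 * E y := h.fderiv_self hy
    rw [map_add, map_smul, smul_eq_mul, hdx] at this
    linarith
  have hda' : fderiv ℝ E y' a' = (2 - t * p') * E y' := by
    have : fderiv ℝ E y' (a' + t • x) = 2 * E y' := h.fderiv_self hy'
    rw [map_add, map_smul, smul_eq_mul, hdx'] at this
    linarith
  set v := w • k + b • x with hv
  set v' := w • k' + b • x with hv'
  have hdv : fderiv ℝ E y v = b * p * E y := by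
    rw [hv, map_add, map_smul, map_smul, hdk, hdx]; simp; ring
  have hdv' : fderiv ℝ E y' v' = b * p' * E y' := by
    rw [hv', map_add, map_smul, map_smul, hdk', hdx']; simp; ring
  have expand : ∀ y v, y ≠ 0 → fderiv ℝ (fderiv ℝ E) y (m • y + v) (m • y + v)
      = 2 * m ^ 2 * E y + 2 * m * fderiv ℝ E y v + fderiv ℝ (fderiv ℝ E) y v v := by
    intro y v hy
    simp only [map_add, map_smul, _root_.add_apply, _root_.smul_apply, smul_eq_mul,
      h.hess_symm hy v y, h.hess_self hy, h.fderiv_self hy]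
    ring
  have hqval : B y' y' = 1 + t ^ 2 * l x := h.bilin_add_smul_vec ha' t
  have hqval' : B y y = 1 + t ^ 2 * l x := h.bilin_add_smul_vec ha t
  -- Cauchy-Schwarz at `y` for the transplanted vector; `I2` below is the corresponding equality at
  -- `y'`.
  have I1 := h.sq_le hy (m • y + v)
  have hlz : l (m • y + v) = l X := by
    rw [hlX, hydef, hv]
    simp only [map_add, map_smul, ha.1, hk.1, smul_eq_mul]
    ring
  rw [hlz, expand y v hy, hdv, hqval'] at I1
  have I2 : fderiv ℝ (fderiv ℝ E) y' X X = l X := hX X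
  rw [hXe, expand y' v' hy', hdv', ← hXe] at I2
  refine ⟨X, hX, hq, m, w, b, hmw, ?_⟩
  rw [hqval] at hq
  set c₀ := l x with hc₀
  have hQ : 0 < 1 + t ^ 2 * c₀ := by positivity
  set N := fderiv ℝ (fderiv ℝ E) y v v with hN
  set N' := fderiv ℝ (fderiv ℝ E) y' v' v' with hN'
  set Ey := E y
  set Ey' := E y'
  have hNE : l X / Ey' ≤ 2 * m ^ 2 + 2 * m * b * p + N / Ey := by
    have e1 : l X ^ 2 = l X * ((1 + t ^ 2 * c₀) / 2) / Ey' := by rw [← hq]; field_simp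
    rw [e1] at I1
    have : (l X / Ey') * (((1 + t ^ 2 * c₀) / 2) * Ey) ≤
        (2 * m ^ 2 + 2 * m * b * p + N / Ey) * (((1 + t ^ 2 * c₀) / 2) * Ey) := by
      calc _ = l X * ((1 + t ^ 2 * c₀) / 2) / Ey' * Ey := by ring
        _ ≤ _ := I1
        _ = _ := by field_simp
    exact le_of_mul_le_mul_right this (by positivity)
  have hNE' : l X / Ey' = 2 * m ^ 2 + 2 * m * b * p' + N' / Ey' := by
    rw [← I2]; field_simp
  refine ⟨?_, ?_⟩
  · have J1 : fderiv ℝ (fderiv ℝ E) y' X y' = l y' := hX y'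
    have hly' : l y' = t * c₀ := by simp [hydef', ha'.1, ← hc₀]
    rw [h.hess_symm hy', h.hess_self hy', hXe, map_add, map_smul, h.fderiv_self hy', hdv',
      hly', smul_eq_mul] at J1
    rw [hlX] at hq
    exact slope_bound hxpos hxle hq J1
  · rw [hdv, hda, hdv', hda'] at C4
    -- The first order condition along `x`.
    have hpp : p - p' = -(e * L * Real.exp (L * t)) := by linarith
    refine barrier_bound hEy hEy' (by positivity) hpp (hNE'.symm.trans_le hNE) (le_trans ?_ C4)
    exact le_of_eq (by ring)

theorem isCompact_unitSphere [FiniteDimensional ℝ V] (h : IsQuadraticGradientEnergy B l x E) :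
    IsCompact {z | B z z = 1} := by
  have hcont : Continuous fun z => B z z := by fun_prop
  have : ProperSpace V := FiniteDimensional.proper_real V
  apply Metric.isCompact_of_isClosed_isBounded (isClosed_eq hcont continuous_const)
  obtain ⟨m, hm, hmb⟩ : ∃ m > 0, ∀ z ∈ Metric.sphere (0 : V) 1, m ≤ B z z := by
    obtain ⟨m, hm, hmb⟩ := (isCompact_sphere (0 : V) 1).exists_forall_le' (a := 0)
      hcont.continuousOn
      (fun z hz => h.bilin_pos z (ne_zero_of_mem_sphere one_ne_zero ⟨z, hz⟩))
    exact ⟨m, hm, hmb⟩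
  refine (Metric.isBounded_iff_subset_closedBall 0).2 ⟨Real.sqrt (1 / m), fun z hz => ?_⟩
  rw [mem_closedBall_zero_iff]
  apply Real.le_sqrt_of_sq_le
  rw [le_div_iff₀ hm]
  by_cases h0 : z = 0
  · simp [h0]
  have hn : ‖z‖ ≠ 0 := norm_ne_zero_iff.2 h0
  have := hmb (‖z‖⁻¹ • z) (by simp [norm_smul, hn])
  simp only [map_smul, _root_.smul_apply, smul_eq_mul] at this
  rw [show B z z = 1 from hz] at this
  calc ‖z‖ ^ 2 * m ≤ ‖z‖ ^ 2 * (‖z‖⁻¹ * (‖z‖⁻¹ * 1)) := by gcongr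
    _ = 1 := by field_simp

theorem isCompact_kerSphere [FiniteDimensional ℝ V] (h : IsQuadraticGradientEnergy B l x E) :
    IsCompact (kerSphere B l) := by
  have : kerSphere B l = {z | B z z = 1} ∩ {z | l z = 0} := by
    ext z; simp [kerSphere, and_comm]
  rw [this]
  exact h.isCompact_unitSphere.inter_right (isClosed_eq l.continuous continuous_const)

theorem continuousOn_fderiv (h : IsQuadraticGradientEnergy B l x E) :
    ContinuousOn (fderiv ℝ E) {0}ᶜ := fun y hy =>
  (((h.smooth y hy).fderiv_right (m := 1) (by norm_num)).continuousAt).continuousWithinAt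

theorem continuousOn_hess (h : IsQuadraticGradientEnergy B l x E) :
    ContinuousOn (fderiv ℝ (fderiv ℝ E)) {0}ᶜ := fun y hy =>
  ((((h.smooth y hy).fderiv_right (m := 1) (by norm_num)).fderiv_right (m := 0)
    (by norm_num)).continuousAt).continuousWithinAt

theorem continuousOn (h : IsQuadraticGradientEnergy B l x E) : ContinuousOn E {0}ᶜ := fun y hy =>
  (h.smooth y hy).continuousAt.continuousWithinAt

/-- All points in question form a compact set avoiding the origin. For `X`, the quotient of `B X X`
by the Hessian length `l X` is bounded by compactness of the unit sphere, and `l X = B y y / (2 E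
y)` is bounded too. -/
theorem exists_uniform_bounds [FiniteDimensional ℝ V] (h : IsQuadraticGradientEnergy B l x E)
    (Z : ℝ) : ∃ M : ℝ, 0 < M ∧ ∀ a ∈ kerSphere B l, ∀ t, |t| ≤ Z →
      E (a + t • x) ≤ M ∧ |logDeriv E x (a + t • x)| ≤ M ∧
      ∀ X, (∀ z, fderiv ℝ (fderiv ℝ E) (a + t • x) X z = l z) →
        E (a + t • x) * l X = B (a + t • x) (a + t • x) / 2 → B X X ≤ M := by
  set K := (fun u : V × ℝ => u.1 + u.2 • x) '' (kerSphere B l ×ˢ Set.Icc (-Z) Z) with hK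
  have hKc : IsCompact K := (h.isCompact_kerSphere.prod isCompact_Icc).image (by fun_prop)
  have hK0 : K ⊆ {0}ᶜ := by
    rintro _ ⟨⟨a, t⟩, ⟨ha, -⟩, rfl⟩
    exact h.add_smul_vec_ne ha t
  have hE := h.continuousOn.mono hK0
  have hEne : ∀ y ∈ K, E y ≠ 0 := fun y hy => (h.pos y (hK0 hy)).ne'
  obtain ⟨M₁, hM₁⟩ := hKc.exists_bound_of_continuousOn hE
  have hld : ContinuousOn (logDeriv E x) K :=
    ((h.continuousOn_fderiv.mono hK0).clm_apply continuousOn_const).div hE hEne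
  obtain ⟨M₂, hM₂⟩ := hKc.exists_bound_of_continuousOn hld
  have hq : ContinuousOn (fun y => B y y / 2 / E y) K := by
    refine ContinuousOn.div ?_ hE hEne
    exact Continuous.continuousOn (by fun_prop)
  obtain ⟨M₃, hM₃⟩ := hKc.exists_bound_of_continuousOn hq
  have hz0 : ∀ z, B z z = 1 → z ≠ 0 := by
    rintro z hz rfl
    simp at hz
  have hg : ContinuousOn (fun u : V × V => (fderiv ℝ (fderiv ℝ E) u.1 u.2 u.2)⁻¹)
      (K ×ˢ {z | B z z = 1}) := by
    refine ContinuousOn.inv₀ ?_ fun u hu => (h.hess_pos u.1 (hK0 hu.1) u.2 (hz0 _ hu.2)).ne'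
    refine ContinuousOn.clm_apply (ContinuousOn.clm_apply ?_ continuousOn_snd) continuousOn_snd
    exact (h.continuousOn_hess.mono hK0).comp continuousOn_fst fun u hu => hu.1
  obtain ⟨M₄, hM₄⟩ := (hKc.prod h.isCompact_unitSphere).exists_bound_of_continuousOn hg
  refine ⟨|M₁| + |M₂| + |M₄| * |M₃| + 1, by positivity, fun a ha t ht => ?_⟩
  have hyK : a + t • x ∈ K := ⟨(a, t), ⟨ha, abs_le.1 ht⟩, rfl⟩
  set y := a + t • x
  have b1 := le_trans (hM₁ y hyK) (le_abs_self M₁)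
  have b2 := le_trans (hM₂ y hyK) (le_abs_self M₂)
  have b3 := le_trans (hM₃ y hyK) (le_abs_self M₃)
  have p34 : 0 ≤ |M₄| * |M₃| := by positivity
  rw [Real.norm_eq_abs] at b1 b2 b3
  refine ⟨?_, ?_, ?_⟩
  · have := le_abs_self (E y)
    have := abs_nonneg M₂
    linarith
  · have := abs_nonneg M₁
    linarith
  · intro X hX hEl
    have hlX : l X = B y y / 2 / E y := by
      rw [← hEl]; field_simp [hEne y hyK]
    rw [← hlX] at b3
    suffices B X X ≤ |M₄| * |M₃| by
      have := abs_nonneg M₁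
      have := abs_nonneg M₂
      linarith
    by_cases h0 : X = 0
    · simpa [h0] using p34
    have hBX := h.bilin_pos X h0
    have hs := Real.sqrt_pos.2 hBX
    have hss := Real.mul_self_sqrt hBX.le
    set r := Real.sqrt (B X X)
    have hmem : B (r⁻¹ • X) (r⁻¹ • X) = 1 := by
      simp only [map_smul, _root_.smul_apply, smul_eq_mul, ← hss]
      field_simp
    have b4 := le_trans (hM₄ (y, r⁻¹ • X) ⟨hyK, hmem⟩) (le_abs_self M₄)
    have hlpos : 0 < l X := by rw [← hX X]; exact h.hess_pos y (hK0 hyK) X h0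
    simp only [map_smul, _root_.smul_apply, smul_eq_mul, hX] at b4
    have b5 := le_trans (le_abs_self _) b4
    have e1 : (r⁻¹ * (r⁻¹ * l X))⁻¹ = B X X / l X := by rw [← hss]; field_simp
    rw [e1, div_le_iff₀ hlpos] at b5
    calc B X X ≤ |M₄| * l X := b5
      _ ≤ |M₄| * |M₃| := by gcongr; exact le_trans (le_abs_self _) b3

/-- Homogeneity isolates `2 log s`, which does not depend on `a` and so cancels in differences, and
leaves a point tending to `c • x` as `s → ∞`. -/
theorem log_add_smul_vec (h : IsQuadraticGradientEnergy B l x E) {a : V}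
    (ha : a ∈ kerSphere B l) {c s : ℝ} (hs : 0 < s) :
    Real.log (E (a + (s * c) • x)) = 2 * Real.log s + Real.log (E (c • x + s⁻¹ • a)) := by
  have h1 : a + (s * c) • x = s • (c • x + s⁻¹ • a) := by
    rw [smul_add, smul_smul, smul_smul, mul_inv_cancel₀ hs.ne', one_smul, add_comm]
  have hne : c • x + s⁻¹ • a ≠ 0 := by
    intro h0
    apply h.add_smul_vec_ne ha (s * c)
    rw [h1, h0, smul_zero]
  rw [h1, h.hom s hs, Real.log_mul (by positivity) (h.pos _ hne).ne', Real.log_pow]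
  norm_num

/-- The difference of the logarithms tends to zero near the two poles. -/
theorem exists_log_sub_log_lt [FiniteDimensional ℝ V] (h : IsQuadraticGradientEnergy B l x E)
    {d : ℝ} (hd : 0 < d) : ∃ Z : ℝ, ∀ t, Z ≤ |t| → ∀ a ∈ kerSphere B l, ∀ a' ∈ kerSphere B l,
      Real.log (E (a + t • x)) - Real.log (E (a' + t • x)) < d := by
  have pole : ∀ c : ℝ, c ≠ 0 → ∃ r > 0, ∀ v, ‖v‖ < r →
      |Real.log (E (c • x + v)) - Real.log (E (c • x))| < d / 2 := by
    intro c hc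
    have hne : c • x ≠ 0 := smul_ne_zero hc h.vec_ne
    have hcont : ContinuousAt (fun y => Real.log (E y)) (c • x) :=
      (h.smooth _ hne).continuousAt.log (h.pos _ hne).ne'
    obtain ⟨r, hr, hb⟩ := Metric.continuousAt_iff.1 hcont (d / 2) (by positivity)
    refine ⟨r, hr, fun v hv => ?_⟩
    have := hb (x := c • x + v) (by simpa [dist_eq_norm] using hv)
    simpa [Real.dist_eq] using this
  obtain ⟨C, hC⟩ := h.isCompact_kerSphere.isBounded.exists_norm_le
  have main : ∀ c : ℝ, c ≠ 0 → ∃ Z : ℝ, 0 < Z ∧ ∀ s, Z ≤ s → ∀ a ∈ kerSphere B l,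
      ∀ a' ∈ kerSphere B l,
      Real.log (E (a + (s * c) • x)) - Real.log (E (a' + (s * c) • x)) < d := by
    intro c hc
    obtain ⟨r, hr, hb⟩ := pole c hc
    refine ⟨(|C| + 1) / r, by positivity, fun s hs a ha a' ha' => ?_⟩
    have hspos : 0 < s := lt_of_lt_of_le (by positivity) hs
    rw [h.log_add_smul_vec ha hspos, h.log_add_smul_vec ha' hspos]
    have small : ∀ a ∈ kerSphere B l, ‖s⁻¹ • a‖ < r := by
      intro a ha
      rw [norm_smul, norm_inv, Real.norm_of_nonneg hspos.le, inv_mul_lt_iff₀ hspos]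
      rw [div_le_iff₀ hr] at hs
      have := hC a ha
      have := le_abs_self C
      linarith
    have k1 := abs_lt.1 (hb _ (small a ha))
    have k2 := abs_lt.1 (hb _ (small a' ha'))
    linarith [k1.2, k2.1]
  -- The signs `c = 1` and `c = -1` treat the two ends of the axis separately, since `E` need not be
  -- even.
  obtain ⟨Z₁, hp₁, hZ₁⟩ := main 1 one_ne_zero
  obtain ⟨Z₂, hp₂, hZ₂⟩ := main (-1) (by norm_num)
  refine ⟨max Z₁ Z₂, fun t ht a ha a' ha' => ?_⟩
  rcases le_total 0 t with h0 | h0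
  · rw [abs_of_nonneg h0] at ht
    simpa using hZ₁ t (le_trans (le_max_left _ _) ht) a ha a' ha'
  · rw [abs_of_nonpos h0] at ht
    simpa using hZ₂ (-t) (le_trans (le_max_right _ _) ht) a ha a' ha'

/-- The slope bound gives `1 ≤ b² T²`, so bounded terms are absorbed into multiples of `b²`, which
is cancelled. Here `e` is the energy at the second point; the height of the barrier does not occur,
so it may be chosen after `L`. -/
theorem exponent_bound {m w b t p p' L M Z e : ℝ} (hM : 0 < M) (hZ : 0 < Z) (ht : |t| ≤ Z)
    (hp : |p| ≤ M) (hp' : |p'| ≤ M) (hmw : m ^ 2 + w ^ 2 ≤ M) (he : 0 < e) (he' : e ≤ M)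
    (hb : 1 ≤ b * (e * (2 - t * p')))
    (hL : b ^ 2 * L ≤ -2 * m * b + t * w ^ 2 - b ^ 2 * (p + p')) :
    L ≤ (1 + Z) * M * (M * (2 + Z * M)) ^ 2 + 1 + 2 * M := by
  set T := M * (2 + Z * M) with hT
  have hTpos : 0 < T := by positivity
  have hb2 : 0 < b ^ 2 := by
    have hb0 : b ≠ 0 := by
      rintro rfl
      norm_num at hb
    positivity
  have hs : |e * (2 - t * p')| ≤ T := by
    rw [abs_mul, abs_of_pos he, hT]
    have : |2 - t * p'| ≤ 2 + Z * M := by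
      calc |2 - t * p'| ≤ |2| + |t * p'| := abs_sub _ _
        _ ≤ 2 + Z * M := by
          rw [abs_mul, abs_two]
          gcongr
    gcongr
  have h1 : 1 ≤ b ^ 2 * T ^ 2 := by
    have : 1 ≤ |b| * T := by
      calc 1 ≤ |b * (e * (2 - t * p'))| := le_trans hb (le_abs_self _)
        _ = |b| * |e * (2 - t * p')| := abs_mul _ _
        _ ≤ |b| * T := by gcongr
    calc (1 : ℝ) ≤ (|b| * T) ^ 2 := one_le_pow₀ this
      _ = b ^ 2 * T ^ 2 := by rw [mul_pow, sq_abs]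
  have i1 : -2 * m * b ≤ M * (b ^ 2 * T ^ 2) + b ^ 2 := by
    nlinarith [sq_nonneg (m + b), sq_nonneg w]
  have i2 : t * w ^ 2 ≤ Z * (M * (b ^ 2 * T ^ 2)) := by
    calc t * w ^ 2 ≤ Z * w ^ 2 := by gcongr; exact le_trans (le_abs_self t) ht
      _ ≤ Z * (M * (b ^ 2 * T ^ 2)) := by
        gcongr
        nlinarith [sq_nonneg m]
  have i3 : -(b ^ 2 * (p + p')) ≤ b ^ 2 * (2 * M) := by
    have := (abs_le.1 hp).1
    have := (abs_le.1 hp').1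
    nlinarith
  have : b ^ 2 * L ≤ b ^ 2 * ((1 + Z) * M * T ^ 2 + 1 + 2 * M) := by nlinarith
  exact le_of_mul_le_mul_left this hb2

theorem log_le_log [FiniteDimensional ℝ V] (h : IsQuadraticGradientEnergy B l x E)
    (hdim : 3 ≤ Module.finrank ℝ V) {a a' : V} (ha : a ∈ kerSphere B l) (ha' : a' ∈ kerSphere B l)
    (t : ℝ) : Real.log (E (a + t • x)) ≤ Real.log (E (a' + t • x)) := by
  by_contra! hlt
  set d := Real.log (E (a + t • x)) - Real.log (E (a' + t • x)) with hd
  have hdpos : 0 < d := sub_pos.2 hlt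
  obtain ⟨Z₀, hZ₀⟩ := h.exists_log_sub_log_lt (half_pos hdpos)
  set Z := max Z₀ (|t| + 1) with hZ
  have htZ : |t| ≤ Z := le_trans (by linarith) (le_max_right _ _)
  have hZpos : 0 < Z := lt_of_lt_of_le (by positivity) (le_max_right _ _)
  obtain ⟨M, hM, hbd⟩ := h.exists_uniform_bounds Z
  -- One more than the bound of `exponent_bound`.
  set L := (1 + Z) * M * (M * (2 + Z * M)) ^ 2 + 1 + 2 * M + 1 with hL
  have hLpos : 0 < L := by positivity
  -- This keeps the barrier at most `d / 2` for `|s| ≤ Z`.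
  set e := d / 2 * Real.exp (-(L * Z)) with he
  have hepos : 0 < e := by positivity
  have hexp : ∀ s, |s| ≤ Z → e * Real.exp (L * s) ≤ d / 2 := by
    intro s hs
    rw [he, mul_assoc, ← Real.exp_add]
    have : Real.exp (-(L * Z) + L * s) ≤ 1 := by
      rw [Real.exp_le_one_iff]
      have : L * s ≤ L * Z := by gcongr; exact le_trans (le_abs_self s) hs
      linarith
    calc d / 2 * Real.exp (-(L * Z) + L * s) ≤ d / 2 * 1 := by gcongr
      _ = d / 2 := mul_one _
  have hcomp : IsCompact (kerSphere B l ×ˢ (kerSphere B l ×ˢ Set.Icc (-Z) Z)) :=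
    h.isCompact_kerSphere.prod (h.isCompact_kerSphere.prod isCompact_Icc)
  have hlogc : ContinuousOn (fun y => Real.log (E y)) {0}ᶜ :=
    h.continuousOn.log fun y hy => (h.pos y hy).ne'
  have hcont : ContinuousOn (fun u : V × V × ℝ => Real.log (E (u.1 + u.2.2 • x))
      - Real.log (E (u.2.1 + u.2.2 • x)) + e * Real.exp (L * u.2.2))
      (kerSphere B l ×ˢ (kerSphere B l ×ˢ Set.Icc (-Z) Z)) := by
    refine ContinuousOn.add (ContinuousOn.sub ?_ ?_) (by fun_prop)
    · exact hlogc.comp (f := fun u : V × V × ℝ => u.1 + u.2.2 • x) (by fun_prop)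
        fun u hu => h.add_smul_vec_ne hu.1 _
    · exact hlogc.comp (f := fun u : V × V × ℝ => u.2.1 + u.2.2 • x) (by fun_prop)
        fun u hu => h.add_smul_vec_ne hu.2.1 _
  obtain ⟨⟨c, c', s⟩, ⟨hc, hc', hs⟩, hmax⟩ := hcomp.exists_isMaxOn
    ⟨(a, a', t), ha, ha', abs_le.1 htZ⟩ hcont
  have hs' : |s| ≤ Z := abs_le.2 hs
  have hmax' : ∀ b ∈ kerSphere B l, ∀ b' ∈ kerSphere B l, ∀ s', |s'| ≤ Z →
      Real.log (E (b + s' • x)) - Real.log (E (b' + s' • x)) + e * Real.exp (L * s') ≤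
      Real.log (E (c + s • x)) - Real.log (E (c' + s • x)) + e * Real.exp (L * s) :=
    fun b hb b' hb' s' hs' => hmax (show (b, b', s') ∈ _ from ⟨hb, hb', abs_le.1 hs'⟩)
  have hsZ : |s| < Z := by
    -- For `|s| = Z` the value is below `d / 2 + d / 2`, while at `(a, a', t)` it exceeds `d`.
    refine lt_of_le_of_ne hs' fun heq => ?_
    have k1 := hmax' a ha a' ha' t htZ
    have k2 := hZ₀ s (by rw [heq]; exact le_max_left _ _) c hc c' hc'
    have k3 := hexp s hs'
    have k4 : 0 < e * Real.exp (L * t) := by positivity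
    linarith
  obtain ⟨X, hX, hq, m, w, b, hmw, hb, hineq⟩ :=
    h.inequality_of_max hdim hc hc' hsZ hepos hLpos hmax'
  have B1 := hbd c hc s hs'
  have B2 := hbd c' hc' s hs'
  have := exponent_bound hM hZpos hs' B1.2.1 B2.2.1 (hmw.trans (B2.2.2 X hX hq))
    (h.pos _ (h.add_smul_vec_ne hc' s)) B2.1 hb hineq
  linarith

/-- The energy is invariant under the rotations about the axis spanned by `x`. -/
theorem energy_eq [FiniteDimensional ℝ V] (h : IsQuadraticGradientEnergy B l x E)
    (hdim : 3 ≤ Module.finrank ℝ V) {v v' : V} (hv : l v = 0) (hv' : l v' = 0)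
    (hvv : B v v = B v' v') (t : ℝ) : E (v + t • x) = E (v' + t • x) := by
  have unit : ∀ a ∈ kerSphere B l, ∀ a' ∈ kerSphere B l, ∀ t : ℝ,
      E (a + t • x) = E (a' + t • x) := fun a ha a' ha' t =>
    Real.log_injOn_pos (h.pos _ (h.add_smul_vec_ne ha t)) (h.pos _ (h.add_smul_vec_ne ha' t))
      (le_antisymm (h.log_le_log hdim ha ha' t) (h.log_le_log hdim ha' ha t))
  by_cases h0 : v = 0
  · have h0' : v' = 0 := by
      by_contra hne
      have := h.bilin_pos v' hne
      rw [← hvv, h0] at this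
      simp at this
    rw [h0, h0']
  have h0' : v' ≠ 0 := by
    rintro rfl
    have := h.bilin_pos v h0
    rw [hvv] at this
    simp at this
  have m1 := h.normalize_mem h0 hv
  have m2 := h.normalize_mem h0' hv'
  rw [← hvv] at m2
  have hr : 0 < Real.sqrt (B v v) := Real.sqrt_pos.2 (h.bilin_pos v h0)
  set r := Real.sqrt (B v v)
  have e1 : ∀ u : V, u + t • x = r • (r⁻¹ • u + (r⁻¹ * t) • x) := by
    intro u
    rw [smul_add, smul_smul, smul_smul, mul_inv_cancel₀ hr.ne', one_smul, ← mul_assoc,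
      mul_inv_cancel₀ hr.ne', one_mul]
  rw [e1 v, e1 v', h.hom r hr, h.hom r hr, unit _ m1 _ m2]

end IsQuadraticGradientEnergy

end Rigidity

/-! ### The tangent bundle chart on `T_pM` and regularity of the energy. -/

section Fibre

variable {n : ℕ} {M : Type*} [TopologicalSpace M] [ChartedSpace (EuclideanSpace ℝ (Fin n)) M]
  [IsManifold (𝓡 n) ∞ M] {F : TangentBundle (𝓡 n) M → ℝ} {S : Set (TangentBundle (𝓡 n) M)}

theorem extChartAt_tangentBundle_self (p : M) (y : EuclideanSpace ℝ (Fin n)) :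
    extChartAt (𝓡 n).tangent (⟨p, 0⟩ : TangentBundle (𝓡 n) M) ⟨p, y⟩ =
      (extChartAt (𝓡 n) p p, y) := by
  have h := tangentCoordChange_self (I := 𝓡 n) (x := p) (z := p) (v := y) (mem_extChartAt_source p)
  exact Prod.ext rfl h

theorem extChartAt_tangentBundle_symm_self (p : M) (y : EuclideanSpace ℝ (Fin n)) :
    (extChartAt (𝓡 n).tangent (⟨p, 0⟩ : TangentBundle (𝓡 n) M)).symm (extChartAt (𝓡 n) p p, y) =
      ⟨p, y⟩ := by
  rw [← extChartAt_tangentBundle_self]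
  apply PartialEquiv.left_inv
  rw [extChartAt_source]
  simp

theorem extChartAt_tangentBundle_symm_fst (p : M)
    (z : EuclideanSpace ℝ (Fin n) × EuclideanSpace ℝ (Fin n)) :
    ((extChartAt (𝓡 n).tangent (⟨p, 0⟩ : TangentBundle (𝓡 n) M)).symm z).1 =
      (extChartAt (𝓡 n) p).symm z.1 := by
  rfl

theorem localEnergy_self (p : M) : localEnergy F p (extChartAt (𝓡 n) p p) = energy F p := by
  funext y
  rw [localEnergy, extChartAt_tangentBundle_symm_self]
  rfl

theorem contDiffAt_comp_chart_symm {p : M} {y : EuclideanSpace ℝ (Fin n)} {k : ℕ∞}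
    (hF : ContMDiffAt (𝓡 n).tangent 𝓘(ℝ, ℝ) k F ⟨p, y⟩) :
    ContDiffAt ℝ k (fun z : EuclideanSpace ℝ (Fin n) × EuclideanSpace ℝ (Fin n) =>
      F ((extChartAt (𝓡 n).tangent (⟨p, 0⟩ : TangentBundle (𝓡 n) M)).symm z))
      (extChartAt (𝓡 n) p p, y) := by
  have : IsManifold (𝓡 n).tangent k (TangentBundle (𝓡 n) M) :=
    IsManifold.of_le (n := ∞) (by exact_mod_cast le_top)
  have h1 : ContMDiffAt (𝓘(ℝ, EuclideanSpace ℝ (Fin n) × EuclideanSpace ℝ (Fin n))) (𝓡 n).tangent k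
    (extChartAt (𝓡 n).tangent (⟨p, 0⟩ : TangentBundle (𝓡 n) M)).symm (extChartAt (𝓡 n) p p, y) := by
    refine (contMDiffOn_extChartAt_symm (I := (𝓡 n).tangent) (n := k)
      (⟨p, 0⟩ : TangentBundle (𝓡 n) M)).contMDiffAt ?_
    refine extChartAt_target_mem_nhds' ?_
    rw [← extChartAt_tangentBundle_self]
    apply PartialEquiv.map_source
    rw [extChartAt_source]
    simp
  rw [← contMDiffAt_iff_contDiffAt]
  refine ContMDiffAt.comp _ ?_ h1
  rw [extChartAt_tangentBundle_symm_self]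
  exact hF

namespace IsFinslerMetric

theorem apply_zero (hF : IsFinslerMetric F S) (p : M) : F ⟨p, 0⟩ = 0 := by
  have := hF.homogeneous p 0 2 (by norm_num)
  rw [smul_zero] at this
  linarith

theorem ne_zero_iff (hF : IsFinslerMetric F S) (w : TangentBundle (𝓡 n) M) :
    F w ≠ 0 ↔ w.2 ≠ 0 := by
  obtain ⟨p, v⟩ := w
  refine ⟨fun h h0 => h ?_, fun h => (hF.pos p v h).ne'⟩
  simp only at h0
  rw [h0, hF.apply_zero]

/-- The zero section is the zero set of the continuous function `F`. -/
theorem isOpen_compl_zero (hF : IsFinslerMetric F S) :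
    IsOpen {w : TangentBundle (𝓡 n) M | w.2 ≠ 0} := by
  have : {w : TangentBundle (𝓡 n) M | w.2 ≠ 0} = F ⁻¹' {0}ᶜ := by
    ext w; exact (hF.ne_zero_iff w).symm
  rw [this]
  exact isOpen_compl_singleton.preimage hF.continuous

theorem contDiffAt_localEnergy (hF : IsFinslerMetric F S) (p : M) {y : EuclideanSpace ℝ (Fin n)}
    (hy : y ≠ 0) : ContDiffAt ℝ 2 (fun z : EuclideanSpace ℝ (Fin n) × EuclideanSpace ℝ (Fin n) =>
      localEnergy F p z.1 z.2) (extChartAt (𝓡 n) p p, y) := by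
  have h1 := hF.contMDiffOn_two.contMDiffAt (hF.isOpen_compl_zero.mem_nhds
    (show (⟨p, y⟩ : TangentBundle (𝓡 n) M) ∈ {w : TangentBundle (𝓡 n) M | w.2 ≠ 0} from hy))
  exact contDiffAt_const.mul ((contDiffAt_comp_chart_symm (k := 2) h1).pow 2)

theorem contDiffAt_localEnergy_smooth (hF : IsFinslerMetric F S) (p : M)
    {y : EuclideanSpace ℝ (Fin n)} (hy : y ≠ 0) (hS : (⟨p, y⟩ : TangentBundle (𝓡 n) M) ∉ S) :
    ContDiffAt ℝ ∞ (fun z : EuclideanSpace ℝ (Fin n) × EuclideanSpace ℝ (Fin n) =>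
      localEnergy F p z.1 z.2) (extChartAt (𝓡 n) p p, y) := by
  have ho : IsOpen {w : TangentBundle (𝓡 n) M | w.2 ≠ 0 ∧ w ∉ S} :=
    hF.isOpen_compl_zero.inter hF.isClosed_exceptional.isOpen_compl
  have h1 := hF.smooth.contMDiffAt (ho.mem_nhds
    (show (⟨p, y⟩ : TangentBundle (𝓡 n) M) ∈ {w : TangentBundle (𝓡 n) M | w.2 ≠ 0 ∧ w ∉ S}
      from ⟨hy, hS⟩))
  exact contDiffAt_const.mul ((contDiffAt_comp_chart_symm (k := ⊤) h1).pow 2)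

end IsFinslerMetric

end Fibre

/-! ### Calculus of partial derivatives. -/

section Partial

variable {m : ℕ} {f g : EuclideanSpace ℝ (Fin m) → ℝ} {y : EuclideanSpace ℝ (Fin m)}

theorem sum_smul_single (v : EuclideanSpace ℝ (Fin m)) :
    ∑ i, v i • EuclideanSpace.single i (1 : ℝ) = v := by
  ext j
  simp [Finset.sum_apply, Pi.single_apply]

theorem clm_apply_eq_sum (A : EuclideanSpace ℝ (Fin m) →L[ℝ] ℝ) (v : EuclideanSpace ℝ (Fin m)) :
    A v = ∑ i, v i * A (EuclideanSpace.single i 1) := by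
  conv_lhs => rw [← sum_smul_single v]
  simp

theorem pd_congr (i : Fin m) (h : f =ᶠ[nhds y] g) : pd i f =ᶠ[nhds y] pd i g := by
  filter_upwards [h.fderiv (𝕜 := ℝ)] with z hz
  simp [pd, hz]

theorem contDiffAt_pd {k j : WithTop ℕ∞} (i : Fin m) (hf : ContDiffAt ℝ k f y) (hj : j + 1 ≤ k) :
    ContDiffAt ℝ j (pd i f) y :=
  (hf.fderiv_right hj).clm_apply contDiffAt_const

theorem differentiableAt_eventually {k : ℕ} (hf : ContDiffAt ℝ (k + 1) f y) :
    ∀ᶠ z in nhds y, DifferentiableAt ℝ f z := by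
  have h1 : ContDiffAt ℝ 1 f y := hf.of_le (by exact_mod_cast Nat.le_add_left 1 k)
  filter_upwards [h1.eventually (by simp)] with z hz using hz.differentiableAt (by norm_num)

theorem pd_add (i : Fin m) (hf : ContDiffAt ℝ 1 f y) (hg : ContDiffAt ℝ 1 g y) :
    pd i (fun z => f z + g z) =ᶠ[nhds y] fun z => pd i f z + pd i g z := by
  filter_upwards [differentiableAt_eventually (k := 0) (by simpa using hf),
    differentiableAt_eventually (k := 0) (by simpa using hg)] with z h1 h2
  simp [pd, fderiv_fun_add h1 h2]

theorem pd_const_mul (i : Fin m) (c : ℝ) : pd i (fun z => c * f z) = fun z => c * pd i f z := by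
  funext z
  have : fderiv ℝ (fun z => c * f z) z = c • fderiv ℝ f z :=
    congrFun (fderiv_const_smul_field (𝕜 := ℝ) (R := ℝ) (f := f) c) z
  simp [pd, this]

/-- Third partial derivatives. -/
def thirdPartial (i j k : Fin m) (f : EuclideanSpace ℝ (Fin m) → ℝ)
    (y : EuclideanSpace ℝ (Fin m)) : ℝ := pd k (pd j (pd i f)) y

theorem thirdPartial_congr (i j k : Fin m) (h : f =ᶠ[nhds y] g) :
    thirdPartial i j k f y = thirdPartial i j k g y :=
  (pd_congr k (pd_congr j (pd_congr i h))).self_of_nhds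

theorem thirdPartial_add (i j k : Fin m) (hf : ContDiffAt ℝ 3 f y) (hg : ContDiffAt ℝ 3 g y) :
    thirdPartial i j k (fun z => f z + g z) y =
      thirdPartial i j k f y + thirdPartial i j k g y := by
  have f1 := contDiffAt_pd (j := 2) i hf (by norm_num)
  have g1 := contDiffAt_pd (j := 2) i hg (by norm_num)
  have f2 := contDiffAt_pd (j := 1) j f1 (by norm_num)
  have g2 := contDiffAt_pd (j := 1) j g1 (by norm_num)
  have e1 := pd_congr k (pd_congr j (pd_add i (hf.of_le (by norm_num)) (hg.of_le (by norm_num))))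
  have e2 := pd_congr k (pd_add j (f1.of_le (by norm_num)) (g1.of_le (by norm_num)))
  have e3 := pd_add k f2 g2
  exact (e1.trans (e2.trans e3)).self_of_nhds

theorem thirdPartial_const_mul (i j k : Fin m) (c : ℝ) :
    thirdPartial i j k (fun z => c * f z) y = c * thirdPartial i j k f y := by
  simp only [thirdPartial, pd_const_mul]

theorem thirdPartial_sum {ι : Type*} (s : Finset ι) (i j k : Fin m)
    {f : ι → EuclideanSpace ℝ (Fin m) → ℝ} (hf : ∀ l, ContDiffAt ℝ 3 (f l) y) :
    thirdPartial i j k (fun z => ∑ l ∈ s, f l z) y = ∑ l ∈ s, thirdPartial i j k (f l) y := by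
  classical
  induction s using Finset.induction_on with
  | empty =>
    have := thirdPartial_const_mul (f := fun _ => (0 : ℝ)) (y := y) i j k 0
    simpa using this
  | insert l s hl ih =>
    simp only [Finset.sum_insert hl]
    rw [thirdPartial_add i j k (hf l) (ContDiffAt.sum fun l _ => hf l), ih]

/-- Disposes of the term `α(y)²` in the contracted spray. -/
theorem thirdPartial_sq (i j k : Fin m) (A : EuclideanSpace ℝ (Fin m) →L[ℝ] ℝ) :
    thirdPartial i j k (fun z => A z ^ 2) y = 0 := by
  have h1 : pd i (fun z => A z ^ 2) = fun z => (2 * A (EuclideanSpace.single i 1)) * A z := by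
    funext z
    have := (A.hasFDerivAt (x := z)).pow 2
    simp [pd, this.fderiv]
    ring
  have h2 : pd j (fun z => A z) = fun _ => A (EuclideanSpace.single j 1) := by
    funext z
    simp [pd, (A.hasFDerivAt (x := z)).fderiv]
  rw [thirdPartial, h1, pd_const_mul, h2]
  simp [pd]

theorem hessian_apply (hf : ContDiffAt ℝ 2 f y) (i j : Fin m) :
    hessian f y i j = fderiv ℝ (fderiv ℝ f) y (EuclideanSpace.single j 1)
      (EuclideanSpace.single i 1) := by
  have hd : DifferentiableAt ℝ (fderiv ℝ f) y :=
    (hf.fderiv_right (m := 1) (by norm_num)).differentiableAt (by norm_num)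
  have := hd.hasFDerivAt.clm_apply (hasFDerivAt_const (EuclideanSpace.single i (1 : ℝ)) y)
  change fderiv ℝ (fun z => fderiv ℝ f z (EuclideanSpace.single i 1)) y _ = _
  rw [this.fderiv]
  simp

theorem hess_apply_eq_sum (hf : ContDiffAt ℝ 2 f y) (v w : EuclideanSpace ℝ (Fin m)) :
    fderiv ℝ (fderiv ℝ f) y v w = ∑ i, ∑ j, hessian f y i j * w i * v j := by
  rw [clm_apply_eq_sum]
  refine Finset.sum_congr rfl fun i _ => ?_
  have := clm_apply_eq_sum ((fderiv ℝ (fderiv ℝ f) y).flip (EuclideanSpace.single i 1)) v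
  simp only [ContinuousLinearMap.flip_apply] at this
  rw [this, Finset.mul_sum]
  refine Finset.sum_congr rfl fun j _ => ?_
  rw [hessian_apply hf]
  ring

theorem contDiffAt_hessian {k j : WithTop ℕ∞} (hf : ContDiffAt ℝ k f y) (hj : j + 1 + 1 ≤ k)
    (a b : Fin m) : ContDiffAt ℝ j (fun z => hessian f z a b) y :=
  contDiffAt_pd (k := j + 1) b (contDiffAt_pd (k := k) a hf hj) le_rfl

end Partial

/-! ### Regularity of inverse matrices, by Cramer's rule. -/

section Matrix

variable {W : Type*} [NormedAddCommGroup W] [NormedSpace ℝ W] {ι : Type*} [Fintype ι]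
  [DecidableEq ι] {k : WithTop ℕ∞} {y : W}

theorem contDiffAt_det {A : W → Matrix ι ι ℝ} (hA : ∀ i j, ContDiffAt ℝ k (fun z => A z i j) y) :
    ContDiffAt ℝ k (fun z => (A z).det) y := by
  simp only [Matrix.det_apply']
  refine ContDiffAt.sum fun σ _ => contDiffAt_const.mul ?_
  exact contDiffAt_prod fun i _ => hA _ _

theorem contDiffAt_inv_apply {A : W → Matrix ι ι ℝ}
    (hA : ∀ i j, ContDiffAt ℝ k (fun z => A z i j) y) (hdet : (A y).det ≠ 0) (i j : ι) :
    ContDiffAt ℝ k (fun z => (A z)⁻¹ i j) y := by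
  simp only [Matrix.inv_def, Ring.inverse_eq_inv', Matrix.smul_apply, smul_eq_mul,
    Matrix.adjugate_apply]
  refine ((contDiffAt_det hA).inv hdet).mul (contDiffAt_det fun a b => ?_)
  simp only [Matrix.updateRow_apply]
  split_ifs
  · exact contDiffAt_const
  · exact hA a b

end Matrix

/-! ### Sprays under conformal change. -/

section Spray

variable {n : ℕ} {M : Type*} [TopologicalSpace M] [ChartedSpace (EuclideanSpace ℝ (Fin n)) M]
  [IsManifold (𝓡 n) ∞ M] {F : TangentBundle (𝓡 n) M → ℝ} {S : Set (TangentBundle (𝓡 n) M)}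
  {α : M → ℝ} {p : M}

theorem localEnergy_conformalChange (x y : EuclideanSpace ℝ (Fin n)) :
    localEnergy (conformalChange α F) p x y =
      Real.exp (2 * α ((extChartAt (𝓡 n) p).symm x)) * localEnergy F p x y := by
  have h2 : ∀ r : ℝ, Real.exp (2 * r) = Real.exp r ^ 2 := fun r => by
    rw [two_mul, Real.exp_add, sq]
  simp only [localEnergy, conformalChange, extChartAt_tangentBundle_symm_fst, h2]
  ring

omit [IsManifold (𝓡 n) ∞ M] in
theorem differentiableAt_comp_chart_symm (hα : MDifferentiableAt (𝓡 n) 𝓘(ℝ, ℝ) α p) :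
    DifferentiableAt ℝ (fun x => α ((extChartAt (𝓡 n) p).symm x)) (extChartAt (𝓡 n) p p) := by
  have h : DifferentiableWithinAt ℝ (fun x => α ((extChartAt (𝓡 n) p).symm x)) (Set.range (𝓡 n))
      (extChartAt (𝓡 n) p p) := hα.differentiableWithinAt_writtenInExtChartAt
  rwa [(𝓡 n).range_eq_univ, differentiableWithinAt_univ] at h

omit [IsManifold (𝓡 n) ∞ M] in
theorem pd_comp_chart_symm (hα : MDifferentiableAt (𝓡 n) 𝓘(ℝ, ℝ) α p) (k : Fin n) :
    pd k (fun x => α ((extChartAt (𝓡 n) p).symm x)) (extChartAt (𝓡 n) p p) = dα α p k := by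
  have h : (mfderiv (𝓡 n) 𝓘(ℝ, ℝ) α p : EuclideanSpace ℝ (Fin n) →L[ℝ] ℝ) =
      fderivWithin ℝ (fun x => α ((extChartAt (𝓡 n) p).symm x)) (Set.range (𝓡 n))
        (extChartAt (𝓡 n) p p) := hα.mfderiv
  rw [(𝓡 n).range_eq_univ, fderivWithin_univ] at h
  exact (congrArg (fun A : EuclideanSpace ℝ (Fin n) →L[ℝ] ℝ => A (EuclideanSpace.single k 1))
    h).symm

omit [IsManifold (𝓡 n) ∞ M] in
theorem mfderiv_apply_eq_sum (v : EuclideanSpace ℝ (Fin n)) :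
    mfderiv (𝓡 n) 𝓘(ℝ, ℝ) α p v = ∑ k, v k * dα α p k :=
  clm_apply_eq_sum (m := n) (mfderiv (𝓡 n) 𝓘(ℝ, ℝ) α p) v

theorem pd_exp_mul {a f : EuclideanSpace ℝ (Fin n) → ℝ} {x : EuclideanSpace ℝ (Fin n)}
    (ha : DifferentiableAt ℝ a x) (hf : DifferentiableAt ℝ f x) (k : Fin n) :
    pd k (fun x => Real.exp (2 * a x) * f x) x =
      Real.exp (2 * a x) * (2 * pd k a x * f x + pd k f x) := by
  have h := ((ha.hasFDerivAt.const_mul 2).exp).mul hf.hasFDerivAt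
  simp only [pd]
  have h' : fderiv ℝ (fun x => Real.exp (2 * a x) * f x) x = _ := h.fderiv
  rw [h']
  simp
  ring

/-- The partial derivative in `x` is the full differential on the product applied to `(e_k, 0)`,
hence jointly regular with one derivative lost. -/
theorem contDiffAt_xPartial {G : EuclideanSpace ℝ (Fin n) → EuclideanSpace ℝ (Fin n) → ℝ}
    {x y : EuclideanSpace ℝ (Fin n)} {j : WithTop ℕ∞}
    (hG : ContDiffAt ℝ (j + 1) (fun z : EuclideanSpace ℝ (Fin n) × EuclideanSpace ℝ (Fin n) =>
      G z.1 z.2) (x, y)) (k : Fin n) :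
    ContDiffAt ℝ j (fun y' => pd k (fun x' => G x' y') x) y := by
  have h1 : ContDiffAt ℝ j (fun y' => fderiv ℝ
      (fun z : EuclideanSpace ℝ (Fin n) × EuclideanSpace ℝ (Fin n) => G z.1 z.2) (x, y')
      (EuclideanSpace.single k 1, 0)) y := by
    refine ContDiffAt.clm_apply ?_ contDiffAt_const
    exact ContDiffAt.comp (g := fderiv ℝ
      (fun z : EuclideanSpace ℝ (Fin n) × EuclideanSpace ℝ (Fin n) => G z.1 z.2))
      (f := fun y' : EuclideanSpace ℝ (Fin n) => (x, y')) y (hG.fderiv_right le_rfl)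
      (contDiffAt_const.prodMk contDiffAt_id)
  refine h1.congr_of_eventuallyEq ?_
  have h2 : ∀ᶠ z in nhds (x, y), DifferentiableAt ℝ
      (fun z : EuclideanSpace ℝ (Fin n) × EuclideanSpace ℝ (Fin n) => G z.1 z.2) z := by
    have : ContDiffAt ℝ 1 (fun z : EuclideanSpace ℝ (Fin n) × EuclideanSpace ℝ (Fin n) =>
      G z.1 z.2) (x, y) := hG.of_le le_add_self
    filter_upwards [this.eventually (by simp)] with z hz using hz.differentiableAt (by norm_num)
  have hc : Filter.Tendsto (fun y' : EuclideanSpace ℝ (Fin n) => (x, y')) (nhds y)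
      (nhds (x, y)) := Continuous.tendsto (by fun_prop) y
  filter_upwards [hc.eventually h2] with y' hy'
  have h3 : HasFDerivAt (fun x' : EuclideanSpace ℝ (Fin n) => (x', y'))
      (ContinuousLinearMap.inl ℝ _ (EuclideanSpace ℝ (Fin n))) x := hasFDerivAt_prodMk_left x y'
  have h4 := HasFDerivAt.comp x (g := fun z : EuclideanSpace ℝ (Fin n) × EuclideanSpace ℝ (Fin n)
    => G z.1 z.2) (hy'.hasFDerivAt) h3
  have h5 : fderiv ℝ (fun x' => G x' y') x = _ := h4.fderiv
  simp [pd, h5]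

theorem differentiableAt_left {G : EuclideanSpace ℝ (Fin n) → EuclideanSpace ℝ (Fin n) → ℝ}
    {x y : EuclideanSpace ℝ (Fin n)}
    (hG : DifferentiableAt ℝ (fun z : EuclideanSpace ℝ (Fin n) × EuclideanSpace ℝ (Fin n) =>
      G z.1 z.2) (x, y)) : DifferentiableAt ℝ (fun x' => G x' y) x :=
  DifferentiableAt.comp x (g := fun z : EuclideanSpace ℝ (Fin n) × EuclideanSpace ℝ (Fin n)
    => G z.1 z.2) (f := fun x' => (x', y)) hG
    (differentiableAt_id.prodMk (differentiableAt_const y))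

namespace IsFinslerMetric

theorem contDiffAt_energy (hF : IsFinslerMetric F S) (p : M) {y : EuclideanSpace ℝ (Fin n)}
    (hy : y ≠ 0) : ContDiffAt ℝ 2 (energy F p) y := by
  rw [← localEnergy_self]
  exact ContDiffAt.comp y (f := fun y => (extChartAt (𝓡 n) p p, y))
    (hF.contDiffAt_localEnergy p hy) (contDiffAt_const.prodMk contDiffAt_id)

theorem contDiffAt_energy_smooth (hF : IsFinslerMetric F S) (p : M)
    {y : EuclideanSpace ℝ (Fin n)} (hy : y ≠ 0) (hS : (⟨p, y⟩ : TangentBundle (𝓡 n) M) ∉ S) :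
    ContDiffAt ℝ ∞ (energy F p) y := by
  rw [← localEnergy_self]
  exact ContDiffAt.comp y (f := fun y => (extChartAt (𝓡 n) p p, y))
    (hF.contDiffAt_localEnergy_smooth p hy hS) (contDiffAt_const.prodMk contDiffAt_id)

theorem energy_pos (hF : IsFinslerMetric F S) (p : M) {y : EuclideanSpace ℝ (Fin n)}
    (hy : y ≠ 0) : 0 < energy F p y := by
  have := hF.pos p y hy
  rw [energy]; positivity

theorem energy_smul (hF : IsFinslerMetric F S) (p : M) (t : ℝ) (ht : 0 < t)
    (y : EuclideanSpace ℝ (Fin n)) : energy F p (t • y) = t ^ 2 * energy F p y := by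
  have := hF.homogeneous p y t ht
  simp only [energy]
  rw [show F ⟨p, t • y⟩ = t * F ⟨p, y⟩ from this]
  ring

theorem energy_zero (hF : IsFinslerMetric F S) (p : M) :
    energy F p (0 : EuclideanSpace ℝ (Fin n)) = 0 := by
  have := hF.apply_zero p
  simp only [energy]
  rw [show F ⟨p, (0 : EuclideanSpace ℝ (Fin n))⟩ = 0 from this]
  simp

theorem det_metric_ne_zero (hF : IsFinslerMetric F S) (p : M) {y : EuclideanSpace ℝ (Fin n)}
    (hy : y ≠ 0) : (metric F p y).det ≠ 0 := (hF.posDef p y hy).det_pos.ne'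

theorem contDiffAt_energyStar (hF : IsFinslerMetric F S) {y : EuclideanSpace ℝ (Fin n)}
    (hy : y ≠ 0) {j : WithTop ℕ∞} (h : ContDiffAt ℝ (j + 1 + 1) (energy F p) y) :
    ContDiffAt ℝ j (energyStar F α p) y := by
  refine (h.of_le ?_).mul (ContDiffAt.sum fun l _ => ContDiffAt.mul ?_ contDiffAt_const)
  · exact le_self_add.trans le_self_add
  · refine ContDiffAt.sum fun m _ => ContDiffAt.mul ?_ contDiffAt_const
    exact contDiffAt_inv_apply (fun a b => contDiffAt_hessian h le_rfl a b)
      (hF.det_metric_ne_zero p hy) l m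

theorem contDiffAt_gradX_smooth (hF : IsFinslerMetric F S) {y : EuclideanSpace ℝ (Fin n)}
    (hy : y ≠ 0) (hS : (⟨p, y⟩ : TangentBundle (𝓡 n) M) ∉ S) (l : Fin n) :
    ContDiffAt ℝ ∞ (gradX F α p l) y := by
  refine ContDiffAt.sum fun m _ => ContDiffAt.mul ?_ contDiffAt_const
  exact contDiffAt_inv_apply
    (fun a b => contDiffAt_hessian (hF.contDiffAt_energy_smooth p hy hS) (by simp) a b)
    (hF.det_metric_ne_zero p hy) l m

theorem contDiffAt_spray (hF : IsFinslerMetric F S) {y : EuclideanSpace ℝ (Fin n)}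
    (hy : y ≠ 0) (hS : (⟨p, y⟩ : TangentBundle (𝓡 n) M) ∉ S) (l : Fin n) :
    ContDiffAt ℝ ∞ (spray F p l (extChartAt (𝓡 n) p p)) y := by
  have hE := hF.contDiffAt_localEnergy_smooth p hy hS
  have hP : ∀ k, ContDiffAt ℝ ∞ (fun y' => pd k (fun x' => localEnergy F p x' y')
      (extChartAt (𝓡 n) p p)) y := fun k => contDiffAt_xPartial (j := ∞) (by simpa using hE) k
  refine contDiffAt_const.mul (ContDiffAt.sum fun m _ => ContDiffAt.mul ?_ (ContDiffAt.sub ?_ ?_))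
  · rw [localEnergy_self]
    exact contDiffAt_inv_apply
      (fun a b => contDiffAt_hessian (hF.contDiffAt_energy_smooth p hy hS) (by simp) a b)
      (hF.det_metric_ne_zero p hy) l m
  · refine ContDiffAt.sum fun k _ => ContDiffAt.mul (by fun_prop) ?_
    exact contDiffAt_pd m (hP k) (by simp)
  · exact hP m

/-- Euler's relation `g^{lm} E_m = y^l`. -/
theorem sum_inv_metric_mul_pd (hF : IsFinslerMetric F S) {y : EuclideanSpace ℝ (Fin n)}
    (hy : y ≠ 0) (l : Fin n) : ∑ m, (metric F p y)⁻¹ l m * pd m (energy F p) y = y l := by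
  have hc := hF.contDiffAt_energy p hy
  have h1 : (metric F p y).mulVec (fun k => y k) = fun m => pd m (energy F p) y := by
    funext m
    have h2 : fderiv ℝ (fderiv ℝ (energy F p)) y y (EuclideanSpace.single m 1)
        = pd m (energy F p) y := by
      rw [fderiv_fderiv_apply_self_of_homogeneous (hF.energy_smul p) hc]; rfl
    rw [← h2, hess_apply_eq_sum hc, Finset.sum_eq_single m]
    · simp [Matrix.mulVec, dotProduct, metric]
    · intro b _ hb
      simp [hb]
    · simp
  have h3 : (metric F p y)⁻¹.mulVec (fun m => pd m (energy F p) y) = fun k => y k := by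
    rw [← h1, Matrix.mulVec_mulVec, Matrix.nonsing_inv_mul _
      (hF.det_metric_ne_zero p hy).isUnit, Matrix.one_mulVec]
  exact congrFun h3 l

/-- The factor `c = e^{2α}` cancels against the inverse Hessian. Differentiating it in `x` adds `2
α(y) E_m - 2 E α_m` to the bracket, and Euler's relation `g^{lm} E_m = y^l` simplifies the first
term. -/
theorem spray_conformalChange (hF : IsFinslerMetric F S)
    (hα : MDifferentiableAt (𝓡 n) 𝓘(ℝ, ℝ) α p) {y : EuclideanSpace ℝ (Fin n)} (hy : y ≠ 0)
    (l : Fin n) :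
    spray (conformalChange α F) p l (extChartAt (𝓡 n) p p) y =
      spray F p l (extChartAt (𝓡 n) p p) y +
        ((∑ k, y k * dα α p k) * y l - energy F p y * gradX F α p l y) := by
  set x₀ := extChartAt (𝓡 n) p p with hx₀
  set c := Real.exp (2 * α ((extChartAt (𝓡 n) p).symm x₀)) with hc
  have hcpos : 0 < c := Real.exp_pos _
  have hE := hF.contDiffAt_localEnergy p hy
  have hdiff : ∀ y', y' ≠ 0 → DifferentiableAt ℝ (fun x' => localEnergy F p x' y') x₀ :=
    fun y' hy' => differentiableAt_left
      ((hF.contDiffAt_localEnergy p hy').differentiableAt (by norm_num))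
  have hx : ∀ k y', y' ≠ 0 →
      pd k (fun x' => localEnergy (conformalChange α F) p x' y') x₀ =
        c * (2 * dα α p k * energy F p y' + pd k (fun x' => localEnergy F p x' y') x₀) := by
    intro k y' hy'
    simp only [localEnergy_conformalChange]
    rw [pd_exp_mul (a := fun x => α ((extChartAt (𝓡 n) p).symm x))
      (differentiableAt_comp_chart_symm hα) (hdiff y' hy'), pd_comp_chart_symm hα,
      ← localEnergy_self]
  have hxy : ∀ m k, pd m (fun y' => pd k (fun x' => localEnergy (conformalChange α F) p x' y') x₀) y
      = c * (2 * dα α p k * pd m (energy F p) y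
        + pd m (fun y' => pd k (fun x' => localEnergy F p x' y') x₀) y) := by
    intro m k
    have hev : (fun y' => pd k (fun x' => localEnergy (conformalChange α F) p x' y') x₀)
        =ᶠ[nhds y] fun y' => c * (2 * dα α p k * energy F p y'
          + pd k (fun x' => localEnergy F p x' y') x₀) := by
      filter_upwards [isOpen_ne.mem_nhds hy] with y' hy' using hx k y' hy'
    have hP : ContDiffAt ℝ 1 (fun y' => pd k (fun x' => localEnergy F p x' y') x₀) y :=
      contDiffAt_xPartial (j := 1) (hE.of_le (by norm_num)) k
    rw [(pd_congr m hev).self_of_nhds, pd_const_mul]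
    have hadd := (pd_add m (f := fun y' => 2 * dα α p k * energy F p y')
      (contDiffAt_const.mul ((hF.contDiffAt_energy p hy).of_le (by norm_num))) hP).self_of_nhds
    rw [pd_const_mul] at hadd
    exact congrArg (c * ·) hadd
  have hhess : hessian (localEnergy (conformalChange α F) p x₀) y = c • metric F p y := by
    have : localEnergy (conformalChange α F) p x₀ = fun y' => c * energy F p y' := by
      funext y'
      rw [localEnergy_conformalChange, ← localEnergy_self]
    rw [this]
    ext i j
    simp [hessian, metric, pd_const_mul]
  have hinv : (c • metric F p y)⁻¹ = c⁻¹ • (metric F p y)⁻¹ := by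
    have := Matrix.inv_smul' (A := metric F p y) (Units.mk0 c hcpos.ne')
      (hF.det_metric_ne_zero p hy).isUnit
    simpa [Units.smul_def] using this
  have hEuler := hF.sum_inv_metric_mul_pd (p := p) hy l
  simp only [spray]
  rw [hhess, hinv, localEnergy_self, show hessian (energy F p) y = metric F p y from rfl]
  simp only [hx _ y hy, hxy, gradX]
  have key : ∀ m, (c⁻¹ • (metric F p y)⁻¹) l m *
      ((∑ k, y k * (c * (2 * dα α p k * pd m (energy F p) y +
        pd m (fun y' => pd k (fun x' => localEnergy F p x' y') x₀) y)))
      - c * (2 * dα α p m * energy F p y + pd m (fun x' => localEnergy F p x' y) x₀)) =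
      (metric F p y)⁻¹ l m *
      ((∑ k, y k * pd m (fun y' => pd k (fun x' => localEnergy F p x' y') x₀) y)
        - pd m (fun x' => localEnergy F p x' y) x₀)
      + 2 * (∑ k, y k * dα α p k) * ((metric F p y)⁻¹ l m * pd m (energy F p) y)
      - 2 * energy F p y * ((metric F p y)⁻¹ l m * dα α p m) := by
    intro m
    have hs : (∑ k, y k * (c * (2 * dα α p k * pd m (energy F p) y +
        pd m (fun y' => pd k (fun x' => localEnergy F p x' y') x₀) y))) =
        c * (2 * (∑ k, y k * dα α p k) * pd m (energy F p) y +
        ∑ k, y k * pd m (fun y' => pd k (fun x' => localEnergy F p x' y') x₀) y) := by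
      rw [Finset.mul_sum, Finset.sum_mul, ← Finset.sum_add_distrib, Finset.mul_sum]
      exact Finset.sum_congr rfl fun k _ => by ring
    rw [hs, Matrix.smul_apply, smul_eq_mul]
    field_simp
    ring
  simp only [key]
  rw [Finset.sum_sub_distrib, Finset.sum_add_distrib, ← Finset.mul_sum, ← Finset.mul_sum, hEuler]
  ring

/-- Invariance of the contracted mixed curvature means that the third derivatives of `E_*`
vanish. -/
theorem thirdPartial_energyStar (hF : IsFinslerMetric F S)
    (hα : MDifferentiableAt (𝓡 n) 𝓘(ℝ, ℝ) α p) {y : EuclideanSpace ℝ (Fin n)} (hy : y ≠ 0)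
    (hS : (⟨p, y⟩ : TangentBundle (𝓡 n) M) ∉ S) (i j k : Fin n)
    (hinv : ∑ l, mixedCurvature (conformalChange α F) p l i j k y * dα α p l =
      ∑ l, mixedCurvature F p l i j k y * dα α p l) :
    thirdPartial i j k (energyStar F α p) y = 0 := by
  set x₀ := extChartAt (𝓡 n) p p
  have h3 : (3 : WithTop ℕ∞) ≤ ∞ := WithTop.coe_le_coe.2 (le_top : (3 : ℕ∞) ≤ ⊤)
  have hcoord : ∀ l : Fin n, ContDiffAt ℝ 3 (fun y : EuclideanSpace ℝ (Fin n) => y l) y :=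
    fun l => by fun_prop
  have hlin : ContDiffAt ℝ 3 (fun y : EuclideanSpace ℝ (Fin n) => ∑ k, y k * dα α p k) y :=
    ContDiffAt.sum fun k _ => (hcoord k).mul contDiffAt_const
  have hE := (hF.contDiffAt_energy_smooth p hy hS).of_le h3
  have hspray := fun l => (hF.contDiffAt_spray (p := p) hy hS l).of_le h3
  have hr : ∀ l, ContDiffAt ℝ 3 (fun y : EuclideanSpace ℝ (Fin n) =>
      (∑ k, y k * dα α p k) * y l - energy F p y * gradX F α p l y) y := fun l =>
    (hlin.mul (hcoord l)).sub (hE.mul ((hF.contDiffAt_gradX_smooth hy hS l).of_le h3))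
  have hmix : ∀ l, mixedCurvature (conformalChange α F) p l i j k y =
      mixedCurvature F p l i j k y - thirdPartial i j k (fun y : EuclideanSpace ℝ (Fin n) =>
        (∑ k, y k * dα α p k) * y l - energy F p y * gradX F α p l y) y := by
    intro l
    have hev : spray (conformalChange α F) p l x₀ =ᶠ[nhds y] fun y =>
        spray F p l x₀ y + ((∑ k, y k * dα α p k) * y l - energy F p y * gradX F α p l y) := by
      filter_upwards [isOpen_ne.mem_nhds hy] with y' hy'
        using hF.spray_conformalChange hα hy' l
    have e1 := thirdPartial_congr i j k hev
    rw [thirdPartial_add i j k (hspray l) (hr l)] at e1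
    have m1 : mixedCurvature (conformalChange α F) p l i j k y =
      -thirdPartial i j k (spray (conformalChange α F) p l x₀) y := rfl
    have m2 : mixedCurvature F p l i j k y = -thirdPartial i j k (spray F p l x₀) y := rfl
    rw [m1, m2, e1]
    ring
  have hzero : ∑ l, dα α p l * thirdPartial i j k (fun y : EuclideanSpace ℝ (Fin n) =>
        (∑ k, y k * dα α p k) * y l - energy F p y * gradX F α p l y) y = 0 := by
    simp only [hmix, sub_mul, Finset.sum_sub_distrib] at hinv
    simp only [mul_comm (dα α p _)]
    linarith
  simp only [← thirdPartial_const_mul] at hzero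
  rw [← thirdPartial_sum Finset.univ i j k
    (fun l => contDiffAt_const.mul (hr l))] at hzero
  set A : EuclideanSpace ℝ (Fin n) →L[ℝ] ℝ := mfderiv (𝓡 n) 𝓘(ℝ, ℝ) α p with hA
  have hAe : ∀ y : EuclideanSpace ℝ (Fin n), A y = ∑ k, y k * dα α p k := fun y =>
    mfderiv_apply_eq_sum y
  have hsum : (fun z : EuclideanSpace ℝ (Fin n) => ∑ l, dα α p l *
      ((∑ k, z k * dα α p k) * z l - energy F p z * gradX F α p l z)) =
      fun z => A z ^ 2 + (-1) * energyStar F α p z := by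
    funext z
    simp only [mul_sub, Finset.sum_sub_distrib, energyStar, hAe]
    rw [sq, Finset.mul_sum, Finset.mul_sum, Finset.mul_sum, sub_eq_add_neg,
      ← Finset.sum_neg_distrib]
    congr 1 <;> refine Finset.sum_congr rfl fun l _ => by ring
  rw [hsum, thirdPartial_add i j k (A.contDiff.contDiffAt.pow 2)
    (contDiffAt_const.mul (hF.contDiffAt_energyStar hy
      ((hF.contDiffAt_energy_smooth p hy hS).of_le
        (WithTop.coe_le_coe.2 (le_top : (3 + 1 + 1 : ℕ∞) ≤ ⊤))))),
    thirdPartial_sq, thirdPartial_const_mul] at hzero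
  linarith

end IsFinslerMetric

end Spray

/-! ### Homogeneous functions with vanishing third derivatives. -/

section Quadratic

variable {m : ℕ} {q : EuclideanSpace ℝ (Fin m) → ℝ}

theorem fderiv_quadratic {V : Type*} [NormedAddCommGroup V] [NormedSpace ℝ V]
    {B : V →L[ℝ] V →L[ℝ] ℝ} (hB : ∀ v w, B v w = B w v) :
    fderiv ℝ (fun w => B w w / 2) = B := by
  funext y
  have h : HasFDerivAt (fun w => B w w) _ y := B.hasFDerivAt.clm_apply (hasFDerivAt_id y)
  have h2 : HasFDerivAt (fun w => B w w / 2) _ y := h.mul_const (2⁻¹ : ℝ)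
  rw [h2.fderiv]
  ext v
  simp [hB v y]
  ring

theorem isConnected_compl_span_singleton (hm : 3 ≤ m) (u : EuclideanSpace ℝ (Fin m)) :
    IsConnected ((Submodule.span ℝ {u} : Submodule ℝ (EuclideanSpace ℝ (Fin m)))ᶜ :
      Set (EuclideanSpace ℝ (Fin m))) := by
  apply isConnected_compl_of_one_lt_codim
  rw [← Module.finrank_eq_rank]
  have h1 := (Submodule.span ℝ {u}).finrank_quotient_add_finrank
  have h2 : Module.finrank ℝ (Submodule.span ℝ {u}) ≤ 1 := by
    simpa using finrank_span_le_card (R := ℝ) ({u} : Set (EuclideanSpace ℝ (Fin m)))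
  rw [finrank_euclideanSpace_fin] at h1
  exact_mod_cast (show 1 < Module.finrank ℝ (EuclideanSpace ℝ (Fin m) ⧸ Submodule.span ℝ {u}) by
    omega)

/-- A `2`-homogeneous function whose third derivatives vanish away from a line is a quadratic
form. -/
theorem exists_quadratic_of_thirdPartial_eq_zero (hm : 3 ≤ m) (u : EuclideanSpace ℝ (Fin m))
    (hom : ∀ t : ℝ, 0 < t → ∀ y, q (t • y) = t ^ 2 * q y)
    (hcont : ∀ y, y ≠ 0 → ContinuousAt q y) (hzero : q 0 = 0)
    (hsmooth : ∀ y, y ∉ Submodule.span ℝ {u} → ContDiffAt ℝ 3 q y)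
    (hthird : ∀ y, y ∉ Submodule.span ℝ {u} → ∀ i j k, thirdPartial i j k q y = 0) :
    ∃ B : EuclideanSpace ℝ (Fin m) →L[ℝ] EuclideanSpace ℝ (Fin m) →L[ℝ] ℝ,
      (∀ v w, B v w = B w v) ∧ ∀ w, q w = B w w / 2 := by
  have hconn := isConnected_compl_span_singleton hm u
  obtain ⟨e, he⟩ := hconn.nonempty
  have he : e ∉ Submodule.span ℝ {u} := he
  have hopen : IsOpen ((Submodule.span ℝ {u} : Submodule ℝ (EuclideanSpace ℝ (Fin m)))ᶜ :
      Set (EuclideanSpace ℝ (Fin m))) :=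
    (Submodule.closed_of_finiteDimensional (Submodule.span ℝ {u})).isOpen_compl
  have hs2 : ∀ y, y ∉ Submodule.span ℝ {u} → ContDiffAt ℝ 2 q y :=
    fun y hy => (hsmooth y hy).of_le (by norm_num)
  have hconst : ∀ y, y ∉ Submodule.span ℝ {u} → hessian q y = hessian q e := by
    intro y hy
    ext i j
    have hd : ∀ z, z ∉ Submodule.span ℝ {u} → ContDiffAt ℝ 1 (fun z => hessian q z i j) z :=
      fun z hz => contDiffAt_hessian (hsmooth z hz) (by norm_num) i j
    obtain ⟨c, hc⟩ := hopen.exists_is_const_of_fderiv_eq_zero (𝕜 := ℝ)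
      (f := fun z => hessian q z i j)
      hconn.isPreconnected
      (fun z hz => ((hd z hz).differentiableAt (by norm_num)).differentiableWithinAt)
      (fun z hz => by
        ext v
        rw [clm_apply_eq_sum]
        refine Finset.sum_eq_zero fun k _ => ?_
        have : fderiv ℝ (fun z => hessian q z i j) z (EuclideanSpace.single k 1) = 0 :=
          hthird z hz i j k
        rw [this, mul_zero])
    exact (hc y hy).trans (hc e he).symm
  refine ⟨fderiv ℝ (fderiv ℝ q) e, fun v w => (hs2 e he).isSymmSndFDerivAt (by simp) v w, ?_⟩
  -- Euler's relation twice: the Hessian at `y`, evaluated on `y` itself, is `2 q y`.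
  have hoff : ∀ y, y ∉ Submodule.span ℝ {u} → q y = fderiv ℝ (fderiv ℝ q) e y y / 2 := by
    intro y hy
    have h1 : fderiv ℝ (fderiv ℝ q) y y y = fderiv ℝ (fderiv ℝ q) e y y := by
      rw [hess_apply_eq_sum (hs2 y hy), hess_apply_eq_sum (hs2 e he), hconst y hy]
    rw [← h1, fderiv_fderiv_apply_self_of_homogeneous hom (hs2 y hy),
      fderiv_apply_self_of_homogeneous hom ((hs2 y hy).differentiableAt (by norm_num))]
    ring
  intro w
  by_cases hw : w ∈ Submodule.span ℝ {u}
  · by_cases h0 : w = 0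
    · simp [h0, hzero]
    -- Points `w + t e` with `t ≠ 0` lie off the line, so the formula extends to `w` by continuity.
    have hline : ContinuousAt (fun t : ℝ => w + t • e) 0 := by fun_prop
    have c1 : Filter.Tendsto (fun t : ℝ => q (w + t • e)) (nhdsWithin 0 {0}ᶜ) (nhds (q w)) := by
      have : ContinuousAt (fun t : ℝ => q (w + t • e)) 0 :=
        ContinuousAt.comp (f := fun t : ℝ => w + t • e) (by simpa using hcont w h0) hline
      simpa using this.tendsto.mono_left nhdsWithin_le_nhds
    have c2 : Filter.Tendsto (fun t : ℝ => fderiv ℝ (fderiv ℝ q) e (w + t • e) (w + t • e) / 2)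
        (nhdsWithin 0 {0}ᶜ) (nhds (fderiv ℝ (fderiv ℝ q) e w w / 2)) := by
      have : ContinuousAt
          (fun t : ℝ => fderiv ℝ (fderiv ℝ q) e (w + t • e) (w + t • e) / 2) 0 := by fun_prop
      simpa using this.tendsto.mono_left nhdsWithin_le_nhds
    refine tendsto_nhds_unique (c1.congr' ?_) c2
    filter_upwards [self_mem_nhdsWithin] with t ht
    apply hoff
    intro hmem
    apply he
    have h1 : t • e ∈ Submodule.span ℝ {u} := by
      simpa using Submodule.sub_mem _ hmem hw
    exact (Submodule.smul_mem_iff _ ht).1 h1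
  · exact hoff w hw

end Quadratic

/-! ### The scalar product of `E_*` and its gradient. -/

section Star

variable {n : ℕ} {M : Type*} [TopologicalSpace M] [ChartedSpace (EuclideanSpace ℝ (Fin n)) M]
  [IsManifold (𝓡 n) ∞ M] {F : TangentBundle (𝓡 n) M → ℝ} {S : Set (TangentBundle (𝓡 n) M)}
  {α : M → ℝ} {p : M}

theorem fderiv_fderiv_smul_of_homogeneous {V : Type*} [NormedAddCommGroup V] [NormedSpace ℝ V]
    {E : V → ℝ} (hom : ∀ t : ℝ, 0 < t → ∀ y, E (t • y) = t ^ 2 * E y)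
    {y : V} {t : ℝ} (ht : 0 < t) :
    fderiv ℝ (fderiv ℝ E) (t • y) = fderiv ℝ (fderiv ℝ E) y := by
  have h1 : (fun z => fderiv ℝ E (t • z)) = t • fderiv ℝ E :=
    funext fun z => fderiv_smul_of_homogeneous hom ht
  have h2 : fderiv ℝ (fun z => fderiv ℝ E (t • z)) y = t • fderiv ℝ (fderiv ℝ E) (t • y) :=
    fderiv_comp_smul (f := fderiv ℝ E) (x := y) t
  have h3 : fderiv ℝ (t • fderiv ℝ E) y = t • fderiv ℝ (fderiv ℝ E) y :=
    congrFun (fderiv_const_smul_field (R := ℝ) (f := fderiv ℝ E) t) y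
  rw [h1, h3] at h2
  exact (smul_right_injective _ ht.ne' h2).symm

omit [IsManifold (𝓡 n) ∞ M] in
theorem mulVec_inv_mulVec {A : Matrix (Fin n) (Fin n) ℝ} (hA : A.PosDef) (b : Fin n → ℝ) :
    A.mulVec (A⁻¹.mulVec b) = b := by
  rw [Matrix.mulVec_mulVec, Matrix.mul_nonsing_inv _ hA.det_pos.ne'.isUnit, Matrix.one_mulVec]

omit [IsManifold (𝓡 n) ∞ M] in
theorem dα_ne_zero (hdα : mfderiv (𝓡 n) 𝓘(ℝ, ℝ) α p ≠ 0) : dα (n := n) α p ≠ 0 := by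
  intro h
  apply hdα
  have : (mfderiv (𝓡 n) 𝓘(ℝ, ℝ) α p : EuclideanSpace ℝ (Fin n) →L[ℝ] ℝ) = 0 := by
    refine ContinuousLinearMap.ext fun v => (mfderiv_apply_eq_sum v).trans ?_
    simp [h]
    rfl
  exact this

namespace IsFinslerMetric

theorem metric_smul (hF : IsFinslerMetric F S) {t : ℝ} (ht : 0 < t)
    {y : EuclideanSpace ℝ (Fin n)} (hy : y ≠ 0) : metric F p (t • y) = metric F p y := by
  ext i j
  rw [metric, metric, hessian_apply (hF.contDiffAt_energy p (smul_ne_zero ht.ne' hy)),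
    hessian_apply (hF.contDiffAt_energy p hy),
    fderiv_fderiv_smul_of_homogeneous (hF.energy_smul p) ht]

theorem energyStar_zero (hF : IsFinslerMetric F S) :
    energyStar F α p (0 : EuclideanSpace ℝ (Fin n)) = 0 := by
  simp [energyStar, hF.energy_zero]

theorem energyStar_smul (hF : IsFinslerMetric F S) (t : ℝ) (ht : 0 < t)
    (y : EuclideanSpace ℝ (Fin n)) :
    energyStar F α p (t • y) = t ^ 2 * energyStar F α p y := by
  by_cases hy : y = 0
  · simp [hy, hF.energyStar_zero]
  simp only [energyStar, gradX, hF.metric_smul ht hy, hF.energy_smul p t ht]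
  ring

theorem energyStar_pos (hF : IsFinslerMetric F S) (hdα : mfderiv (𝓡 n) 𝓘(ℝ, ℝ) α p ≠ 0)
    {y : EuclideanSpace ℝ (Fin n)} (hy : y ≠ 0) : 0 < energyStar F α p y := by
  refine mul_pos (hF.energy_pos p hy) ?_
  have h := (hF.posDef p y hy).inv.dotProduct_mulVec_pos (dα_ne_zero hdα)
  have e : ∑ l, gradX F α p l y * dα α p l =
      star (dα α p) ⬝ᵥ ((metric F p y)⁻¹.mulVec (dα α p)) := by
    simp [dotProduct, Matrix.mulVec, gradX, mul_comm]
  rw [e]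
  exact h

omit [IsManifold (𝓡 n) ∞ M] in
/-- The matrix `metricStar` represents the scalar product whose energy is `E_*`. -/
theorem metricStar_apply {B : EuclideanSpace ℝ (Fin n) →L[ℝ] EuclideanSpace ℝ (Fin n) →L[ℝ] ℝ}
    (hB : ∀ v w, B v w = B w v) (hq : ∀ w, energyStar F α p w = B w w / 2)
    (v w : EuclideanSpace ℝ (Fin n)) :
    B v w = ∑ i, ∑ j, metricStar F α p i j * w i * v j := by
  have hfun : energyStar F α p = fun w => B w w / 2 := funext hq
  have hc : ContDiffAt ℝ 2 (energyStar F α p) 0 := by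
    rw [hfun]; fun_prop
  have h2 : fderiv ℝ (fderiv ℝ (energyStar F α p)) 0 = B := by
    rw [hfun, fderiv_quadratic hB]
    exact B.fderiv
  rw [metricStar, ← hess_apply_eq_sum hc, h2]

theorem posDef_metricStar (hF : IsFinslerMetric F S) (hdα : mfderiv (𝓡 n) 𝓘(ℝ, ℝ) α p ≠ 0)
    {B : EuclideanSpace ℝ (Fin n) →L[ℝ] EuclideanSpace ℝ (Fin n) →L[ℝ] ℝ}
    (hB : ∀ v w, B v w = B w v) (hq : ∀ w, energyStar F α p w = B w w / 2) :
    (metricStar F α p).PosDef := by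
  have happ := metricStar_apply hB hq
  have entry : ∀ i j, metricStar F α p i j =
      B (EuclideanSpace.single j 1) (EuclideanSpace.single i 1) := by
    intro i j
    rw [happ, Finset.sum_eq_single i, Finset.sum_eq_single j]
    · simp
    · intro b _ hb; simp [hb]
    · simp
    · intro b _ hb; simp [hb]
    · simp
  refine Matrix.PosDef.of_dotProduct_mulVec_pos ?_ fun x hx => ?_
  · ext i j
    simp [entry, hB]
  · have hx' : (WithLp.toLp 2 x : EuclideanSpace ℝ (Fin n)) ≠ 0 := by
      simpa using hx
    have h1 := hF.energyStar_pos hdα hx'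
    rw [hq, happ] at h1
    have : star x ⬝ᵥ ((metricStar F α p).mulVec x) =
        ∑ i, ∑ j, metricStar F α p i j * x i * x j := by
      simp only [dotProduct, Matrix.mulVec, Finset.mul_sum]
      refine Finset.sum_congr rfl fun i _ => Finset.sum_congr rfl fun j _ => ?_
      simp
      ring
    rw [this]
    simpa using h1

/-- Passage from the coordinate data at `p` to the rigidity setting: `gradStar` represents `dα` with
respect to `B`, and `gradX` is its gradient for the Hessian of `E`. -/
theorem isQuadraticGradientEnergy (hF : IsFinslerMetric F S)
    (hdα : mfderiv (𝓡 n) 𝓘(ℝ, ℝ) α p ≠ 0)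
    {B : EuclideanSpace ℝ (Fin n) →L[ℝ] EuclideanSpace ℝ (Fin n) →L[ℝ] ℝ}
    (hB : ∀ v w, B v w = B w v) (hq : ∀ w, energyStar F α p w = B w w / 2) :
    IsQuadraticGradientEnergy B (mfderiv (𝓡 n) 𝓘(ℝ, ℝ) α p :) (gradStar F α p)
      (energy F p) := by
  set l : EuclideanSpace ℝ (Fin n) →L[ℝ] ℝ := mfderiv (𝓡 n) 𝓘(ℝ, ℝ) α p with hl
  have hle : ∀ v, l v = ∑ k, v k * dα α p k := fun v => mfderiv_apply_eq_sum v
  have hpd := hF.posDef_metricStar hdα hB hq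
  have hrepr : ∀ v, B (gradStar F α p) v = l v := by
    intro v
    rw [metricStar_apply hB hq, hle]
    refine Finset.sum_congr rfl fun i _ => ?_
    have := congrFun (mulVec_inv_mulVec hpd (dα α p)) i
    rw [← this]
    simp only [Matrix.mulVec, dotProduct, gradStar, Finset.mul_sum]
    refine Finset.sum_congr rfl fun j _ => Finset.sum_congr rfl fun k _ => by ring
  refine ⟨hB, fun v hv => ?_, hrepr, fun h0 => ?_, fun y hy => hF.energy_pos p hy,
    hF.energy_smul p, fun y hy => hF.contDiffAt_energy p hy, fun y hy z hz => ?_,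
    fun y hy => ⟨WithLp.toLp 2 fun l => gradX F α p l y, fun z => ?_, ?_⟩⟩
  · have := hF.energyStar_pos hdα hv
    rw [hq] at this
    linarith
  · apply hdα
    have : l = 0 := by
      ext v
      rw [← hrepr, h0]
      simp
    exact this
  · rw [hess_apply_eq_sum (hF.contDiffAt_energy p hy)]
    have hz' : (fun i => z i) ≠ 0 := fun h => hz (by ext i; exact congrFun h i)
    have h := (hF.posDef p y hy).dotProduct_mulVec_pos hz'
    refine h.trans_eq ?_
    simp only [dotProduct, Matrix.mulVec, Finset.mul_sum]
    refine Finset.sum_congr rfl fun i _ => Finset.sum_congr rfl fun j _ => ?_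
    simp [metric]
    ring
  · rw [hess_apply_eq_sum (hF.contDiffAt_energy p hy), hle]
    refine Finset.sum_congr rfl fun i _ => ?_
    have := congrFun (mulVec_inv_mulVec (hF.posDef p y hy) (dα α p)) i
    rw [← this]
    simp only [Matrix.mulVec, dotProduct, gradX, Finset.mul_sum, metric]
    refine Finset.sum_congr rfl fun j _ => Finset.sum_congr rfl fun k _ => by ring
  · rw [← hq, hle, energyStar]

end IsFinslerMetric

end Star

/-! ### The constant `K` and the conclusion. -/

namespace IsQuadraticGradientEnergy

variable {V : Type*} [NormedAddCommGroup V] [NormedSpace ℝ V] [FiniteDimensional ℝ V]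
  {B : V →L[ℝ] V →L[ℝ] ℝ} {l : V →L[ℝ] ℝ} {x : V} {E : V → ℝ}

/-- The logarithmic derivative of the energy along `x` at the points of `ker l` is inversely
proportional to the norm of `B`. -/
theorem exists_const_deriv_div (h : IsQuadraticGradientEnergy B l x E)
    (hdim : 3 ≤ Module.finrank ℝ V) : ∃ K : ℝ, ∀ v, v ≠ 0 → l v = 0 →
      DifferentiableAt ℝ (fun t : ℝ => E (v + t • x)) 0 ∧
      deriv (fun t : ℝ => E (v + t • x)) 0 / E v = K / Real.sqrt (B v v) := by
  obtain ⟨a, ha, -⟩ := h.exists_orthogonal hdim 0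
  have hdiff : ∀ v, v ≠ 0 →
      HasDerivAt (fun t : ℝ => E (v + t • x)) (fderiv ℝ E v x) 0 := by
    intro v hv
    have hc : HasDerivAt (fun t : ℝ => v + t • x) x 0 := by
      simpa using ((hasDerivAt_id (0 : ℝ)).smul_const x).const_add v
    have hE : HasFDerivAt E (fderiv ℝ E v) ((fun t : ℝ => v + t • x) 0) := by
      simpa using ((h.smooth v hv).differentiableAt (by norm_num)).hasFDerivAt
    exact hE.comp_hasDerivAt 0 hc
  have ha0 : a ≠ 0 := by simpa using h.add_smul_vec_ne ha 0
  refine ⟨fderiv ℝ E a x / E a, fun v hv hlv => ⟨(hdiff v hv).differentiableAt, ?_⟩⟩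
  have hBv := h.bilin_pos v hv
  have hr : 0 < Real.sqrt (B v v) := Real.sqrt_pos.2 hBv
  have hrr := Real.mul_self_sqrt hBv.le
  set r := Real.sqrt (B v v)
  -- By rotational invariance `v` may be replaced by `r • a`, with `a` a fixed unit vector of `ker
  -- l`; then `E` scales by `r²` and its differential by `r`.
  have hBr : B v v = B (r • a) (r • a) := by
    simp only [map_smul, _root_.smul_apply, smul_eq_mul, ha.2, ← hrr]
    ring
  have heq : ∀ t : ℝ, E (v + t • x) = E (r • a + t • x) :=
    h.energy_eq hdim hlv (by simp [ha.1]) hBr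
  have hra : r • a ≠ 0 := smul_ne_zero hr.ne' ha0
  have hEv : E v = r ^ 2 * E a := by
    have := heq 0
    simp only [zero_smul, add_zero] at this
    rw [this, h.hom r hr]
  have hEa := h.pos a ha0
  rw [funext heq, (hdiff _ hra).deriv, fderiv_smul_of_homogeneous h.hom hr, hEv,
    _root_.smul_apply, smul_eq_mul]
  field_simp

end IsQuadraticGradientEnergy

end ConformalFinsler

end

open ConformalFinsler in
theorem theorem4 {n : ℕ} (hn : 3 ≤ n) {M : Type*} [TopologicalSpace M]
    [ChartedSpace (EuclideanSpace ℝ (Fin n)) M] [IsManifold (𝓡 n) ∞ M]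
    (F : TangentBundle (𝓡 n) M → ℝ) (S : Set (TangentBundle (𝓡 n) M))
    (hF : IsFinslerMetric F S)
    (α : M → ℝ) (hα : ContMDiff (𝓡 n) 𝓘(ℝ, ℝ) ∞ α)
    (p : M) (hdα : mfderiv (𝓡 n) 𝓘(ℝ, ℝ) α p ≠ 0)
    (u : TangentSpace (𝓡 n) p)
    (hS : ∀ v : TangentSpace (𝓡 n) p, (⟨p, v⟩ : TangentBundle (𝓡 n) M) ∈ S →
      ∃ c : ℝ, v = c • u)
    (hcurv : IndicatrixPositivelyCurved F S p)
    (hinv : ∀ v : TangentSpace (𝓡 n) p, v ≠ 0 → (⟨p, v⟩ : TangentBundle (𝓡 n) M) ∉ S →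
      ∀ i j k : Fin n,
        ∑ l, mixedCurvature (conformalChange α F) p l i j k v * dα α p l =
          ∑ l, mixedCurvature F p l i j k v * dα α p l) :
    (metricStar F α p).PosDef ∧
    (∀ w : EuclideanSpace ℝ (Fin n),
      energyStar F α p w = (1 / 2) * ∑ i, ∑ j, metricStar F α p i j * w i * w j) ∧
    ∃ K : ℝ, ∀ v : TangentSpace (𝓡 n) p, v ≠ 0 → mfderiv (𝓡 n) 𝓘(ℝ, ℝ) α p v = 0 →
      0 < normStar F α p v ∧
      0 < energyOnLine F α p v 0 ∧
      DifferentiableAt ℝ (energyOnLine F α p v) 0 ∧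
      deriv (energyOnLine F α p v) 0 / energyOnLine F α p v 0 = K / normStar F α p v := by
  have hα' : MDifferentiableAt (𝓡 n) 𝓘(ℝ, ℝ) α p := hα.mdifferentiableAt (by simp)
  obtain ⟨w, hw⟩ : ∃ w : EuclideanSpace ℝ (Fin n), ∀ y : EuclideanSpace ℝ (Fin n),
      (⟨p, y⟩ : TangentBundle (𝓡 n) M) ∈ S → ∃ c : ℝ, y = c • w := ⟨u, hS⟩
  have hoff : ∀ y : EuclideanSpace ℝ (Fin n), y ∉ Submodule.span ℝ {w} →
      y ≠ 0 ∧ (⟨p, y⟩ : TangentBundle (𝓡 n) M) ∉ S := by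
    intro y hy
    refine ⟨fun h0 => hy (h0 ▸ Submodule.zero_mem _), fun hyS => hy ?_⟩
    obtain ⟨c, hc⟩ := hw y hyS
    exact Submodule.mem_span_singleton.2 ⟨c, hc.symm⟩
  -- Since `E_*` involves second derivatives of `E`, class `C²` of the energy gives just its
  -- continuity in the exceptional directions, and that is all that is needed there.
  obtain ⟨B, hB, hq⟩ := exists_quadratic_of_thirdPartial_eq_zero (q := energyStar F α p) hn w
    hF.energyStar_smul
    (fun y hy => (hF.contDiffAt_energyStar (j := 0) hy
      ((hF.contDiffAt_energy p hy).of_le (by norm_num))).continuousAt)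
    hF.energyStar_zero
    (fun y hy => hF.contDiffAt_energyStar (hoff y hy).1
      ((hF.contDiffAt_energy_smooth p (hoff y hy).1 (hoff y hy).2).of_le
        (WithTop.coe_le_coe.2 (le_top : (3 + 1 + 1 : ℕ∞) ≤ ⊤))))
    (fun y hy i j k => hF.thirdPartial_energyStar hα' (hoff y hy).1 (hoff y hy).2 i j k
      (hinv y (hoff y hy).1 (hoff y hy).2 i j k))
  have hQ := hF.isQuadraticGradientEnergy hdα hB hq
  refine ⟨hF.posDef_metricStar hdα hB hq, fun w => ?_, ?_⟩
  · rw [hq, IsFinslerMetric.metricStar_apply hB hq]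
    ring
  · obtain ⟨K, hK⟩ := hQ.exists_const_deriv_div (by simpa using hn)
    have hnorm : ∀ v : EuclideanSpace ℝ (Fin n), normStar F α p v = Real.sqrt (B v v) := by
      intro v
      rw [normStar, hq]
      congr 1
      ring
    have hzero : ∀ v : EuclideanSpace ℝ (Fin n), energyOnLine F α p v 0 = energy F p v := by
      intro v
      simp [energyOnLine]
    refine ⟨K, fun v hv hv0 => ⟨?_, ?_, (hK v hv hv0).1, ?_⟩⟩
    · exact (Real.sqrt_pos.2 (hQ.bilin_pos v hv)).trans_eq (hnorm v).symm
    · exact (hF.energy_pos p hv).trans_eq (hzero v).symm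
    · refine Eq.trans ?_ ((hK v hv hv0).2.trans (congrArg (K / ·) (hnorm v).symm))
      exact congrArg (deriv (energyOnLine F α p v) 0 / ·) (hzero v)
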